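/- For $\tau,z\in\mathbb C$ with $\operatorname{Im}\tau>0$ put $q^{r}=e^{2\pi i r\tau}$ ($r\in\mathbb C$), and for $a,b\in\{0,1\}$ let $$\vartheta_{ab}(\tau,z)=\sum_{m\in\mathbb Z}e^{\pi i(m+\frac a2)^2\tau+2\pi i(m+\frac a2)(z+\frac b2)}$$ be Mumford's theta functions. Let $n\in\mathbb Z_{\ge 0}$. Each of the following eight formulas holds for all $\tau$ with $\operatorname{Im}\tau>0$ and all $z\in\mathbb C$ for which no denominator in the series on its left-hand side vanishes; under this condition the series converges absolutely and the theta function in the denominator on the right-hand side is nonzero. 1) (i) $\displaystyle 2\sum_{j\in\mathbb Z}\frac{e^{2\pi ijz}q^{\frac12j^2}}{1-e^{2\pi iz}q^{j+n}}=q^{\frac12n^2}\Big\{-i\,\vartheta_{00}(\tau,0)\frac{\vartheta_{01}(\tau,z)\vartheta_{10}(\tau,z)}{\vartheta_{11}(\tau,z)}+\sum_{k=0}^{2n}q^{-\frac12(k-n)^2}\vartheta_{00}(\tau,z)\Big\}$ (ii) $\displaystyle 2\sum_{j\in\mathbb Z}\frac{e^{2\pi i(j-\frac12)z}q^{\frac12(j-\frac12)^2}}{1-e^{2\pi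 iz}q^{j+n}}=q^{\frac12(n+\frac12)^2}\Big\{-i\,\vartheta_{10}(\tau,0)\frac{\vartheta_{01}(\tau,z)\vartheta_{00}(\tau,z)}{\vartheta_{11}(\tau,z)}+\sum_{k=0}^{2n+1}q^{-\frac12(k-n-\frac12)^2}\vartheta_{10}(\tau,z)\Big\}$ (iii) $\displaystyle 2\sum_{j\in\mathbb Z}\frac{e^{2\pi ijz}q^{\frac12j^2}}{1-e^{2\pi iz}q^{j+n+\frac12}}=q^{\frac12(n+\frac12)^2}\Big\{-i\,\vartheta_{10}(\tau,0)\frac{\vartheta_{10}(\tau,z)\vartheta_{11}(\tau,z)}{\vartheta_{01}(\tau,z)}+\sum_{k=0}^{2n+1}q^{-\frac12(k-n-\frac12)^2}\vartheta_{00}(\tau,z)\Big\}$ (iv) $\displaystyle 2\sum_{j\in\mathbb Z}\frac{e^{2\pi i(j+\frac12)z}q^{\frac12(j+\frac12)^2}}{1-e^{2\pi iz}q^{j+n+\frac12}}=q^{\frac12n^2}\Big\{-i\,\vartheta_{00}(\tau,0)\frac{\vartheta_{00}(\tau,z)\vartheta_{11}(\tau,z)}{\vartheta_{01}(\tau,z)}+\sum_{k=0}^{2n}q^{-\frac12(k-n)^2}\vartheta_{10}(\tau,z)\Big\}$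 2) (i) $\displaystyle 2\sum_{j\in\mathbb Z}(-1)^j\frac{e^{2\pi ijz}q^{\frac12j^2}}{1+e^{2\pi iz}q^{j+n}}=q^{\frac12n^2}\Big\{i\,\vartheta_{00}(\tau,0)\frac{\vartheta_{00}(\tau,z)\vartheta_{11}(\tau,z)}{\vartheta_{10}(\tau,z)}+\sum_{k=0}^{2n}q^{-\frac12(k-n)^2}\vartheta_{01}(\tau,z)\Big\}$ (ii) $\displaystyle 2\sum_{j\in\mathbb Z}(-1)^j\frac{e^{2\pi i(j-\frac12)z}q^{\frac12(j-\frac12)^2}}{1+e^{2\pi iz}q^{j+n}}=q^{\frac12(n+\frac12)^2}\Big\{-\vartheta_{10}(\tau,0)\frac{\vartheta_{01}(\tau,z)\vartheta_{00}(\tau,z)}{\vartheta_{10}(\tau,z)}+i\sum_{k=0}^{2n+1}q^{-\frac12(k-n-\frac12)^2}\vartheta_{11}(\tau,z)\Big\}$ (iii) $\displaystyle 2\sum_{j\in\mathbb Z}(-1)^j\frac{e^{2\pi ijz}q^{\frac12j^2}}{1+e^{2\pi iz}q^{j+n+\frac12}}=q^{\frac12(n+\frac12)^2}\Big\{i\,\vartheta_{10}(\tau,0)\frac{\vartheta_{11}(\tau,z)\vartheta_{10}(\tau,z)}{\vartheta_{00}(\tau,z)}+\sum_{k=0}^{2n+1}q^{-\frac12(k-n-\frac12)^2}\vartheta_{01}(\tau,z)\Big\}$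 (iv) $\displaystyle 2\sum_{j\in\mathbb Z}(-1)^j\frac{e^{2\pi i(j+\frac12)z}q^{\frac12(j+\frac12)^2}}{1+e^{2\pi iz}q^{j+n+\frac12}}=q^{\frac12n^2}\Big\{\vartheta_{00}(\tau,0)\frac{\vartheta_{01}(\tau,z)\vartheta_{10}(\tau,z)}{\vartheta_{00}(\tau,z)}-i\sum_{k=0}^{2n}q^{-\frac12(k-n)^2}\vartheta_{11}(\tau,z)\Big\}$ -/

import Mathlib

namespace AppellSum

noncomputable section

/-- Mumford's theta function `ϑ_{ab}(τ, z)`, with half-integral characteristics `a/2`, `b/2`: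
`∑_{m ∈ ℤ} exp(πi (m + a/2)² τ + 2πi (m + a/2)(z + b/2))`. -/
def theta (a b : ℤ) (τ z : ℂ) : ℂ :=
  ∑' m : ℤ, Complex.exp
    (Real.pi * Complex.I * ((m : ℂ) + (a : ℂ) / 2) ^ 2 * τ
      + 2 * Real.pi * Complex.I * ((m : ℂ) + (a : ℂ) / 2) * (z + (b : ℂ) / 2))

/-- `e(w) = exp(2πi w)`. -/
def e (w : ℂ) : ℂ := Complex.exp (2 * Real.pi * Complex.I * w)

/-- The power `q^r` for `q = exp(2πi τ)`, that is `exp(2πi r τ)` (no branch choice involved). -/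
def qpow (τ r : ℂ) : ℂ := Complex.exp (2 * Real.pi * Complex.I * r * τ)

end

end AppellSum

open Filter Topology

namespace AppellSum

noncomputable section

/-! Write `A_s(z) = ∑_j e((j+s)z) q^{j²/2+sj} / (1 - e(z) q^j)` (`appell`). With `s = -(n + a/2)`,
`a ∈ {0,1}`, shifting the index by `n` and completing the square turns the series of 1)(i) and
1)(ii) into `q^{(n+a/2)²/2} A_s(z)`. The formula is then `2 A_s = (A_s + A_{1-s}) + (A_s -
A_{1-s})`.

The difference telescopes: in `A_s - A_{s+1}` every denominator cancels and a theta series is left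
(`appell_sub_appell_add_one`). As `1 - s` exceeds `s` by `2n + 1 + a`, this produces the finite sum.

The sum is a theta quotient (`appell_add_appell`). By `A_s(-z) = -A_{1-s}(z)` it is odd. It has the
same multipliers under `z ↦ z + 1` and `z ↦ z + τ` as the quotient, and the same residue at `0`, by
Jacobi's derivative formula. The discrepancy `D` is odd and regular, so it vanishes at `0`; then `D
/ ϑ₁₁` extends to a bounded entire function that changes sign under `z ↦ z + τ`, hence is zero
(`eq_zero_of_odd_of_quasiperiodic`).

The location and simplicity of the zeros of `ϑ₁₁` and the derivative formula come from the Jacobi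
triple product, obtained as the limit of a finite `q`-binomial identity. The other six formulas
follow by `z ↦ z + τ/2` and `z ↦ z + 1/2`. -/

/-- The infinite product `∏_{n ≥ 0} (1 + a qⁿ)`. -/
def qProd (q a : ℂ) : ℂ := ∏' n : ℕ, (1 + a * q ^ n)

/-! ### Infinite products and Euler's identity. -/

section qProd

variable {q : ℂ}

lemma summable_norm_mul_pow (hq : ‖q‖ < 1) (a : ℂ) : Summable fun n : ℕ => ‖a * q ^ n‖ := by
  simp only [norm_mul, norm_pow]
  exact (summable_geometric_of_lt_one (norm_nonneg q) hq).mul_left _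

lemma multipliable_one_add_mul_pow (hq : ‖q‖ < 1) (a : ℂ) :
    Multipliable fun n : ℕ => 1 + a * q ^ n :=
  multipliable_one_add_of_summable (summable_norm_mul_pow hq a)

lemma tendsto_prod_range_qProd (hq : ‖q‖ < 1) (a : ℂ) :
    Tendsto (fun N => ∏ n ∈ Finset.range N, (1 + a * q ^ n)) atTop (𝓝 (qProd q a)) :=
  (multipliable_one_add_mul_pow hq a).hasProd.tendsto_prod_nat

lemma qProd_ne_zero (hq : ‖q‖ < 1) {a : ℂ} (h : ∀ n : ℕ, 1 + a * q ^ n ≠ 0) : qProd q a ≠ 0 :=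
  tprod_one_add_ne_zero_of_summable h (summable_norm_mul_pow hq a)

lemma qProd_eq_mul (hq : ‖q‖ < 1) (a : ℂ) : qProd q a = (1 + a) * qProd q (a * q) := by
  have h : ∀ n : ℕ, 1 + a * q ^ (n + 1) = 1 + a * q * q ^ n := fun n => by ring
  rw [qProd, tprod_eq_zero_mul' (by simpa only [h] using multipliable_one_add_mul_pow hq (a * q)),
    qProd]
  simp only [h, pow_zero, mul_one]

lemma continuous_qProd (hq : ‖q‖ < 1) : Continuous (qProd q) := by
  rw [continuous_iff_continuousAt]
  intro a
  have h := Summable.multipliableUniformlyOn_nat_one_add (f := fun n (b : ℂ) => b * q ^ n)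
    (isCompact_closedBall a 1)
    ((summable_geometric_of_lt_one (norm_nonneg q) hq).mul_left (‖a‖ + 1))
    (Eventually.of_forall fun n b hb => by
      rw [norm_mul, norm_pow]
      gcongr
      have := norm_le_norm_add_norm_sub' b a
      rw [Metric.mem_closedBall, dist_eq_norm] at hb
      linarith) (fun n => by fun_prop)
  have h2 := h.hasProdUniformlyOn.tendstoUniformlyOn.continuousOn
    (Eventually.of_forall fun s => by fun_prop).frequently
  exact h2.continuousAt (Metric.closedBall_mem_nhds a one_pos)

lemma one_add_mul_pow_ne_zero (hq : ‖q‖ < 1) {a : ℂ} (ha : ‖a‖ < 1) (n : ℕ) :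
    1 + a * q ^ n ≠ 0 := by
  intro h
  have h1 : ‖a * q ^ n‖ = 1 := by
    rw [← norm_neg, show -(a * q ^ n) = 1 by linear_combination -h, norm_one]
  have h2 : ‖a * q ^ n‖ ≤ ‖a‖ * 1 := by
    rw [norm_mul, norm_pow]
    gcongr
    exact pow_le_one₀ (norm_nonneg q) hq.le
  linarith

/-- Euler's identity `∏ (1 + qⁿ)(1 - q^{2n-1}) = 1`, with `q = x²`. -/
lemma qProd_mul_qProd_mul_qProd {x : ℂ} (hx : ‖x‖ < 1) :
    qProd (x ^ 2) x * qProd (x ^ 2) (-x) * qProd (x ^ 2) (x ^ 2) = 1 := by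
  have hq : ‖x ^ 2‖ < 1 := by
    rw [norm_pow]; exact pow_lt_one₀ (norm_nonneg x) hx two_ne_zero
  -- Multiply by `∏ (1 - x² qⁿ)`: pairing the four products by difference of squares gives exactly
  -- the even and the odd factors of this same product, which can then be cancelled.
  have hne : qProd (x ^ 2) (-x ^ 2) ≠ 0 :=
    qProd_ne_zero hq (one_add_mul_pow_ne_zero hq (by rwa [norm_neg]))
  have m := multipliable_one_add_mul_pow hq
  refine mul_right_cancel₀ hne ?_
  rw [one_mul, mul_assoc, qProd, qProd, qProd, qProd, ← (m x).tprod_mul (m (-x)),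
    ← (m (x ^ 2)).tprod_mul (m (-x ^ 2))]
  have e1 : ∀ n : ℕ, (1 + x * (x ^ 2) ^ n) * (1 + -x * (x ^ 2) ^ n)
      = 1 + -x ^ 2 * (x ^ 2) ^ (2 * n) := fun n => by ring
  have e2 : ∀ n : ℕ, (1 + x ^ 2 * (x ^ 2) ^ n) * (1 + -x ^ 2 * (x ^ 2) ^ n)
      = 1 + -x ^ 2 * (x ^ 2) ^ (2 * n + 1) := fun n => by ring
  have m1 := (m x).mul (m (-x))
  have m2 := (m (x ^ 2)).mul (m (-x ^ 2))
  simp only [e1] at m1 ⊢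
  simp only [e2] at m2 ⊢
  exact tprod_even_mul_odd (f := fun n => 1 + -x ^ 2 * (x ^ 2) ^ n) m1 m2

end qProd

/-! ### Gaussian binomials and the finite `q`-binomial theorem. -/

section qBinomial

/-- The finite product `(1 - q)(1 - q²)⋯(1 - q^m)`. -/
def qFactorial (q : ℂ) (m : ℕ) : ℂ := ∏ k ∈ Finset.range m, (1 + -q * q ^ k)

/-- The Gaussian binomial coefficient, by its Pascal recursion. -/
def qBinomial (q : ℂ) : ℕ → ℕ → ℂ
  | _, 0 => 1
  | 0, _ + 1 => 0
  | M + 1, k + 1 => qBinomial q M (k + 1) + q ^ (M - k) * qBinomial q M k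

lemma qBinomial_eq_zero (q : ℂ) : ∀ {M k : ℕ}, M < k → qBinomial q M k = 0
  | _, 0, h => absurd h (Nat.not_lt_zero _)
  | 0, _ + 1, _ => by rw [qBinomial]
  | M + 1, k + 1, h => by
    rw [qBinomial, qBinomial_eq_zero q (by omega : M < k + 1),
      qBinomial_eq_zero q (by omega : M < k), mul_zero, add_zero]

lemma qFactorial_succ (q : ℂ) (m : ℕ) :
    qFactorial q (m + 1) = qFactorial q m * (1 - q ^ (m + 1)) := by
  rw [qFactorial, Finset.prod_range_succ, ← qFactorial]
  ring

/-- Induction through Pascal's rule, using `1 - q^{k+l+2} = (1 - q^{l+1}) + q^{l+1} (1 - q^{k+1})`.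
The indexing by `k + l` avoids both subtraction and division. -/
lemma qBinomial_mul_qFactorial (q : ℂ) :
    ∀ k l : ℕ, qBinomial q (k + l) k * (qFactorial q k * qFactorial q l) = qFactorial q (k + l)
  | 0, l => by simp [qBinomial, qFactorial]
  | k + 1, 0 => by
    have h := qBinomial_mul_qFactorial q k 0
    simp only [add_zero] at h ⊢
    rw [qBinomial, qBinomial_eq_zero q (Nat.lt_succ_self k), qFactorial_succ, Nat.sub_self]
    linear_combination (1 - q ^ (k + 1)) * h
  | k + 1, l + 1 => by
    have h1 := qBinomial_mul_qFactorial q (k + 1) l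
    have h2 := qBinomial_mul_qFactorial q k (l + 1)
    rw [show k + 1 + (l + 1) = (k + l + 1) + 1 by ring, qBinomial,
      show k + l + 1 - k = l + 1 by omega, qFactorial_succ q (k + l + 1)]
    rw [show k + 1 + l = k + l + 1 by ring] at h1
    rw [show k + (l + 1) = k + l + 1 by ring] at h2
    rw [qFactorial_succ q k] at h1 ⊢
    rw [qFactorial_succ q l] at h2 ⊢
    linear_combination (1 - q ^ (l + 1)) * h1 + q ^ (l + 1) * (1 - q ^ (k + 1)) * h2

/-- Multiplying by the new factor `1 + y q^M` reproduces Pascal's rule coefficientwise, because `q^M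
= q^{M-k} q^k` and `k(k+1)/2 = k(k-1)/2 + k`. -/
theorem prod_one_add_mul_pow_eq_sum (q y : ℂ) (M : ℕ) :
    ∏ k ∈ Finset.range M, (1 + y * q ^ k)
      = ∑ k ∈ Finset.range (M + 1), qBinomial q M k * q ^ (k * (k - 1) / 2) * y ^ k := by
  induction M with
  | zero => simp [qBinomial]
  | succ M ih =>
    rw [Finset.prod_range_succ, ih, mul_add, mul_one]
    rw [Finset.sum_range_succ' _ (M + 1)]
    have hterm : ∀ k ∈ Finset.range (M + 1),
        qBinomial q (M + 1) (k + 1) * q ^ ((k + 1) * (k + 1 - 1) / 2) * y ^ (k + 1)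
        = qBinomial q M (k + 1) * q ^ ((k + 1) * (k + 1 - 1) / 2) * y ^ (k + 1)
          + qBinomial q M k * q ^ (k * (k - 1) / 2) * y ^ k * (y * q ^ M) := by
      intro k hk
      have hk : k ≤ M := by simpa [Nat.lt_succ_iff] using hk
      have h2 : (k + 1) * (k + 1 - 1) / 2 = k * (k - 1) / 2 + k := by
        have := Finset.sum_range_id (k + 1)
        rw [Finset.sum_range_succ, Finset.sum_range_id] at this
        exact this.symm
      have hM : q ^ M = q ^ (M - k) * q ^ k := by rw [← pow_add, Nat.sub_add_cancel hk]
      rw [qBinomial, h2, hM]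
      ring
    rw [Finset.sum_congr rfl hterm, Finset.sum_add_distrib, ← Finset.sum_mul]
    have h0 : ∑ k ∈ Finset.range (M + 1), qBinomial q M k * q ^ (k * (k - 1) / 2) * y ^ k
        = ∑ k ∈ Finset.range (M + 1),
            qBinomial q M (k + 1) * q ^ ((k + 1) * (k + 1 - 1) / 2) * y ^ (k + 1)
          + qBinomial q M 0 * q ^ (0 * (0 - 1) / 2) * y ^ 0 := by
      rw [← Finset.sum_range_succ' (fun k => qBinomial q M k * q ^ (k * (k - 1) / 2) * y ^ k)
        (M + 1), Finset.sum_range_succ _ (M + 1), qBinomial_eq_zero q (Nat.lt_succ_self M)]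
      ring
    rw [show qBinomial q (M + 1) 0 = qBinomial q M 0 by simp [qBinomial]]
    nth_rewrite 1 [h0]
    ring

end qBinomial

/-! ### The Jacobi triple product. -/

section TripleProduct

variable {x y : ℂ}

lemma prod_pow_odd (x : ℂ) (N : ℕ) : ∏ k ∈ Finset.range N, x ^ (2 * k + 1) = x ^ (N ^ 2) := by
  rw [Finset.prod_pow_eq_pow_sum]
  congr 1
  induction N with
  | zero => rfl
  | succ N ih => rw [Finset.sum_range_succ, ih]; ring

/-- The finite form of the Jacobi triple product. -/
lemma prod_mul_prod_eq_sum_qBinomial (hx : x ≠ 0) (hy : y ≠ 0) (N : ℕ) :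
    (∏ k ∈ Finset.range N, (1 + x * y * (x ^ 2) ^ k))
        * ∏ k ∈ Finset.range N, (1 + x * y⁻¹ * (x ^ 2) ^ k)
      = ∑ k ∈ Finset.range (2 * N + 1),
          qBinomial (x ^ 2) (2 * N) k * (x ^ (((k : ℤ) - N) ^ 2) * y ^ ((k : ℤ) - N)) := by
  -- With this argument the last `N` of the `2N` factors are the `1 + x y q^k`, while the first `N`,
  -- in reverse order, are `y x^{-(2k+1)} (1 + x y⁻¹ q^k)`.
  have key := prod_one_add_mul_pow_eq_sum (x ^ 2) (y * x ^ (1 - 2 * N : ℤ)) (2 * N)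
  have hfirst : ∏ k ∈ Finset.range N, (1 + x * y⁻¹ * (x ^ 2) ^ k)
      = (y ^ N)⁻¹ * x ^ (N ^ 2)
        * ∏ k ∈ Finset.range N, (1 + y * x ^ (1 - 2 * N : ℤ) * (x ^ 2) ^ k) := by
    have hyN : (y ^ N)⁻¹ = ∏ _k ∈ Finset.range N, y⁻¹ := by simp
    rw [← Finset.prod_range_reflect (fun k => 1 + y * x ^ (1 - 2 * N : ℤ) * (x ^ 2) ^ k),
      ← prod_pow_odd, hyN, ← Finset.prod_mul_distrib, ← Finset.prod_mul_distrib]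
    refine Finset.prod_congr rfl fun k hk => ?_
    have hk : k < N := Finset.mem_range.1 hk
    have hp : (x ^ (2 * k + 1)) * (x ^ (1 - 2 * N : ℤ) * (x ^ 2) ^ (N - 1 - k)) = 1 := by
      rw [← zpow_natCast, ← pow_mul, ← zpow_natCast, ← zpow_add₀ hx, ← zpow_add₀ hx]
      convert zpow_zero x using 2
      push_cast [show 1 ≤ N by omega, show k ≤ N - 1 by omega]
      ring
    have hy' := inv_mul_cancel₀ hy
    linear_combination (-(y⁻¹ * y)) * hp - hy'
  rw [two_mul, Finset.prod_range_add, ← two_mul] at key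
  have hsecond : ∏ k ∈ Finset.range N, (1 + y * x ^ (1 - 2 * N : ℤ) * (x ^ 2) ^ (N + k))
      = ∏ k ∈ Finset.range N, (1 + x * y * (x ^ 2) ^ k) := by
    refine Finset.prod_congr rfl fun k _ => ?_
    have hp : x ^ (1 - 2 * N : ℤ) * (x ^ 2) ^ N = x := by
      rw [← pow_mul, ← zpow_natCast, ← zpow_add₀ hx]
      convert zpow_one x using 2
      push_cast
      ring
    rw [pow_add]
    linear_combination y * (x ^ 2) ^ k * hp
  rw [hsecond] at key
  rw [hfirst, mul_left_comm, mul_comm (∏ k ∈ _, (1 + x * y * (x ^ 2) ^ k)), key, Finset.mul_sum]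
  refine Finset.sum_congr rfl fun k _ => ?_
  have hk2 : (x ^ 2) ^ (k * (k - 1) / 2) = x ^ ((k : ℤ) ^ 2 - k) := by
    rw [← pow_mul, Nat.mul_div_cancel' (Nat.even_mul_pred_self k).two_dvd, ← zpow_natCast]
    congr 1
    rcases k with _ | k
    · simp
    · push_cast [Nat.add_sub_cancel]
      ring
  have hxx : x ^ (N ^ 2) * (x ^ ((k : ℤ) ^ 2 - k) * (x ^ (1 - 2 * N : ℤ)) ^ k)
      = x ^ (((k : ℤ) - N) ^ 2) := by
    rw [← zpow_natCast, ← zpow_natCast (x ^ (1 - 2 * N : ℤ)), ← zpow_mul, ← zpow_add₀ hx,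
      ← zpow_add₀ hx]
    congr 1
    push_cast
    ring
  have hyy : y ^ ((k : ℤ) - N) = (y ^ N)⁻¹ * y ^ k := by
    rw [zpow_sub₀ hy, zpow_natCast, zpow_natCast, div_eq_inv_mul]
  rw [hk2, ← hxx, hyy, mul_pow]
  ring

lemma tendsto_qFactorial {q : ℂ} (hq : ‖q‖ < 1) :
    Tendsto (qFactorial q) atTop (𝓝 (qProd q (-q))) :=
  tendsto_prod_range_qProd hq (-q)

lemma qFactorial_ne_zero {q : ℂ} (hq : ‖q‖ < 1) (m : ℕ) : qFactorial q m ≠ 0 :=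
  Finset.prod_ne_zero_iff.2 fun k _ => one_add_mul_pow_ne_zero hq (by rwa [norm_neg]) k

lemma qProd_neg_self_ne_zero {q : ℂ} (hq : ‖q‖ < 1) : qProd q (-q) ≠ 0 :=
  qProd_ne_zero hq (one_add_mul_pow_ne_zero hq (by rwa [norm_neg]))

lemma qBinomial_eq_div {q : ℂ} (hq : ‖q‖ < 1) (k l : ℕ) :
    qBinomial q (k + l) k = qFactorial q (k + l) * ((qFactorial q k)⁻¹ * (qFactorial q l)⁻¹) := by
  have h := qBinomial_mul_qFactorial q k l
  rw [← mul_inv, ← div_eq_mul_inv]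
  exact eq_div_of_mul_eq (mul_ne_zero (qFactorial_ne_zero hq k) (qFactorial_ne_zero hq l)) h

/-- The `q`-factorials and their inverses both converge, hence are bounded. The uniform bound
provides the majorant for dominated convergence. -/
lemma exists_norm_qBinomial_le {q : ℂ} (hq : ‖q‖ < 1) :
    ∃ C : ℝ, ∀ k l : ℕ, ‖qBinomial q (k + l) k‖ ≤ C := by
  obtain ⟨A, hA⟩ := (tendsto_qFactorial hq).norm.bddAbove_range
  obtain ⟨B, hB⟩ := ((tendsto_qFactorial hq).inv₀ (qProd_neg_self_ne_zero hq)).norm.bddAbove_range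
  have hA' : ∀ m, ‖qFactorial q m‖ ≤ A := fun m => hA ⟨m, rfl⟩
  have hB' : ∀ m, ‖(qFactorial q m)⁻¹‖ ≤ B := fun m => hB ⟨m, rfl⟩
  have hA0 : 0 ≤ A := (norm_nonneg _).trans (hA' 0)
  have hB0 : 0 ≤ B := (norm_nonneg _).trans (hB' 0)
  refine ⟨A * (B * B), fun k l => ?_⟩
  rw [qBinomial_eq_div hq, norm_mul, norm_mul]
  gcongr
  exacts [hA' _, hB' _, hB' _]

/-- The **Jacobi triple product** identity. -/
theorem tsum_zpow_sq_mul_zpow (hx : ‖x‖ < 1) (hx0 : x ≠ 0) (hy : y ≠ 0)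
    (hs : Summable fun j : ℤ => x ^ (j ^ 2) * y ^ j) :
    ∑' j : ℤ, x ^ (j ^ 2) * y ^ j
      = qProd (x ^ 2) (-x ^ 2) * qProd (x ^ 2) (x * y) * qProd (x ^ 2) (x * y⁻¹) := by
  have hq : ‖x ^ 2‖ < 1 := by
    rw [norm_pow]; exact pow_lt_one₀ (norm_nonneg x) hx two_ne_zero
  set q := x ^ 2 with hqdef
  set L := qProd q (-q) with hL
  have hL0 : L ≠ 0 := qProd_neg_self_ne_zero hq
  -- The finite identity, centred and extended by zero to all of `ℤ`. For fixed `j` the binomial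
  -- tends to `L / (L · L) = L⁻¹`.
  let f : ℕ → ℤ → ℂ := fun N j =>
    if j ∈ Finset.Icc (-N : ℤ) N then
      qBinomial q (2 * N) (j + N).toNat * (x ^ (j ^ 2) * y ^ j) else 0
  have hfsum : ∀ N : ℕ, ∑' j, f N j
      = (∏ k ∈ Finset.range N, (1 + x * y * q ^ k))
        * ∏ k ∈ Finset.range N, (1 + x * y⁻¹ * q ^ k) := by
    intro N
    rw [prod_mul_prod_eq_sum_qBinomial hx0 hy N, tsum_eq_sum (s := Finset.Icc (-N : ℤ) N)
      (fun j hj => if_neg hj)]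
    refine Finset.sum_bij' (fun j _ => (j + N).toNat) (fun k _ => (k : ℤ) - N) ?_ ?_ ?_ ?_ ?_
    · intro j hj
      rw [Finset.mem_Icc] at hj
      rw [Finset.mem_range]
      omega
    · intro k hk
      rw [Finset.mem_range] at hk
      rw [Finset.mem_Icc]
      omega
    · intro j hj
      rw [Finset.mem_Icc] at hj
      omega
    · intro k hk
      simp
    · intro j hj
      have hj' := Finset.mem_Icc.1 hj
      have : (((j + N).toNat : ℕ) : ℤ) - N = j := by omega
      simp only [if_pos hj, this]
      rfl
  have hsplit : ∀ (N : ℕ) (j : ℤ), j ∈ Finset.Icc (-N : ℤ) N →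
      2 * N = (j + N).toNat + (N - j).toNat := by
    intro N j hj
    rw [Finset.mem_Icc] at hj
    omega
  obtain ⟨C, hC⟩ := exists_norm_qBinomial_le hq
  have hC0 : 0 ≤ C := (norm_nonneg _).trans (hC 0 0)
  have hlim : Tendsto (fun N => ∑' j, f N j) atTop
      (𝓝 (∑' j : ℤ, L⁻¹ * (x ^ (j ^ 2) * y ^ j))) := by
    refine tendsto_tsum_of_dominated_convergence (hs.norm.mul_left C) (fun j => ?_)
      (Eventually.of_forall fun N j => ?_)
    · have hmem : ∀ᶠ N : ℕ in atTop, j ∈ Finset.Icc (-N : ℤ) N := by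
        filter_upwards [eventually_ge_atTop j.natAbs] with N hN
        rw [Finset.mem_Icc]
        omega
      have ht : Tendsto (fun N : ℕ => qFactorial q (2 * N)
          * ((qFactorial q (j + N).toNat)⁻¹ * (qFactorial q (N - j).toNat)⁻¹)) atTop
          (𝓝 (L * (L⁻¹ * L⁻¹))) := by
        have hF := tendsto_qFactorial hq
        refine (hF.comp ?_).mul (((hF.comp ?_).inv₀ hL0).mul ((hF.comp ?_).inv₀ hL0)) <;>
        refine tendsto_atTop.2 fun b => ?_ <;>
        filter_upwards [eventually_ge_atTop (b + j.natAbs)] with N hN <;> omega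
      rw [mul_inv_cancel_left₀ hL0] at ht
      refine (ht.mul_const (x ^ (j ^ 2) * y ^ j)).congr' ?_
      filter_upwards [hmem] with N hN
      have h := qBinomial_eq_div hq (j + N).toNat (N - j).toNat
      rw [← hsplit N j hN] at h
      simp only [f, if_pos hN, h]
    · by_cases hj : j ∈ Finset.Icc (-N : ℤ) N
      · simp only [f, if_pos hj]
        rw [norm_mul]
        gcongr
        have h := hC (j + N).toNat (N - j).toNat
        rwa [← hsplit N j hj] at h
      · simp only [f, if_neg hj, norm_zero]
        positivity
  have hlim' := (tendsto_prod_range_qProd hq (x * y)).mul (tendsto_prod_range_qProd hq (x * y⁻¹))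
  simp only [hfsum] at hlim
  have h := tendsto_nhds_unique hlim hlim'
  rw [tsum_mul_left, inv_mul_eq_iff_eq_mul₀ hL0] at h
  rw [h, mul_assoc]

end TripleProduct

/-! ### The exponential `e`. -/

section Characters

lemma e_add (u v : ℂ) : e (u + v) = e u * e v := by
  rw [e, e, e, ← Complex.exp_add, mul_add]

lemma e_neg (u : ℂ) : e (-u) = (e u)⁻¹ := by
  rw [e, e, ← Complex.exp_neg, mul_neg]

lemma e_ne_zero (u : ℂ) : e u ≠ 0 := Complex.exp_ne_zero _

lemma e_zero : e 0 = 1 := by rw [e, mul_zero, Complex.exp_zero]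

lemma e_int (n : ℤ) : e n = 1 := by
  rw [e, mul_comm]
  exact Complex.exp_int_mul_two_pi_mul_I n

lemma e_half : e (1 / 2) = -1 := by
  rw [e, show 2 * Real.pi * Complex.I * (1 / 2) = Real.pi * Complex.I by ring, Complex.exp_pi_mul_I]

lemma e_quarter : e (1 / 4) = Complex.I := by
  rw [e, show 2 * Real.pi * Complex.I * (1 / 4) = Real.pi / 2 * Complex.I by ring,
    Complex.exp_pi_div_two_mul_I]

lemma e_add_int (u : ℂ) (n : ℤ) : e (u + n) = e u := by rw [e_add, e_int, mul_one]

lemma e_sub_half (u : ℂ) : e (u - 1 / 2) = -e u := by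
  rw [sub_eq_add_neg, e_add, e_neg, e_half, inv_neg_one, mul_neg_one]

lemma e_int_mul (n : ℤ) (u : ℂ) : e (n * u) = e u ^ n := by
  rw [e, e, ← Complex.exp_int_mul]
  congr 1
  ring

lemma qpow_eq_e (τ r : ℂ) : qpow τ r = e (r * τ) := by
  rw [qpow, e, ← mul_assoc]

lemma e_eq_one_iff (u : ℂ) : e u = 1 ↔ ∃ n : ℤ, u = n := by
  rw [e, Complex.exp_eq_one_iff]
  refine exists_congr fun n => ?_
  rw [mul_comm, mul_left_inj' Complex.two_pi_I_ne_zero]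

lemma norm_e (u : ℂ) : ‖e u‖ = Real.exp (-(2 * Real.pi * u.im)) := by
  rw [e, Complex.norm_exp]
  congr 1
  simp

lemma differentiable_e : Differentiable ℂ e := by
  unfold e
  fun_prop

lemma jacobiTheta₂_term_eq_e (n : ℤ) (z τ : ℂ) :
    jacobiTheta₂_term n z τ = e (n * z + (n : ℂ) ^ 2 / 2 * τ) := by
  rw [jacobiTheta₂_term, e]
  congr 1
  ring

lemma hasDerivAt_e_zero : HasDerivAt e (2 * Real.pi * Complex.I) 0 := by
  have h := ((hasDerivAt_id (0 : ℂ)).const_mul (2 * Real.pi * Complex.I)).cexp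
  rw [show e = fun z => Complex.exp (2 * Real.pi * Complex.I * z) from rfl]
  simpa using h

/-- `(1 - e(z)) / z → -2πi` as `z → 0`. -/
lemma tendsto_one_sub_e_div :
    Tendsto (fun z => (1 - e z) / z) (𝓝[≠] 0) (𝓝 (-(2 * Real.pi * Complex.I))) := by
  have h := (hasDerivAt_iff_tendsto_slope_zero.1 hasDerivAt_e_zero).neg
  refine h.congr fun z => ?_
  rw [zero_add, e_zero, smul_eq_mul]
  ring

end Characters

/-! ### Translations and parity of the theta functions. -/

section Shifts

variable (a b : ℤ) (τ z : ℂ)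

lemma theta_eq_tsum_e :
    theta a b τ z = ∑' m : ℤ,
      e ((m + a / 2 : ℂ) ^ 2 / 2 * τ + (m + a / 2 : ℂ) * (z + b / 2)) := by
  rw [theta]
  refine tsum_congr fun m => ?_
  rw [e]
  congr 1
  ring

lemma theta_eq_jacobiTheta₂ :
    theta a b τ z
      = e ((a : ℂ) ^ 2 / 8 * τ + a / 2 * (z + b / 2)) * jacobiTheta₂ (z + b / 2 + a / 2 * τ) τ := by
  rw [theta_eq_tsum_e, jacobiTheta₂, ← tsum_mul_left]
  refine tsum_congr fun m => ?_
  rw [jacobiTheta₂_term_eq_e, ← e_add]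
  congr 1
  ring

lemma theta_add_half : theta a b τ (z + 1 / 2) = theta a (b + 1) τ z := by
  rw [theta_eq_tsum_e, theta_eq_tsum_e]
  refine tsum_congr fun m => ?_
  congr 1
  push_cast
  ring

lemma theta_add_tau_half :
    theta a b τ (z + 1 / 2 * τ)
      = e (-(1 / 8 * τ) - 1 / 2 * z - b / 4) * theta (a + 1) b τ z := by
  rw [theta_eq_tsum_e, theta_eq_tsum_e, ← tsum_mul_left]
  refine tsum_congr fun m => ?_
  rw [← e_add]
  congr 1
  push_cast
  ring

lemma theta_add_two_mul_left (k : ℤ) : theta (a + 2 * k) b τ z = theta a b τ z := by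
  rw [theta_eq_tsum_e, theta_eq_tsum_e]
  conv_rhs => rw [← (Equiv.addRight k).tsum_eq]
  refine tsum_congr fun m => ?_
  rw [Equiv.coe_addRight]
  congr 1
  push_cast
  ring

lemma theta_add_two_left : theta (a + 2) b τ z = theta a b τ z :=
  theta_add_two_mul_left a b τ z 1

lemma theta_add_two_right : theta a (b + 2) τ z = e (a / 2) * theta a b τ z := by
  rw [theta_eq_tsum_e, theta_eq_tsum_e, ← tsum_mul_left]
  refine tsum_congr fun m => ?_
  rw [← e_add, ← e_add_int (_ / _ + _) m]
  congr 1
  push_cast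
  ring

lemma theta_add_one : theta a b τ (z + 1) = e (a / 2) * theta a b τ z := by
  rw [← theta_add_two_right, show z + 1 = z + 1 / 2 + 1 / 2 by ring, theta_add_half,
    theta_add_half, add_assoc]
  rfl

lemma theta_add_tau :
    theta a b τ (z + τ) = e (-z - b / 2 - 1 / 2 * τ) * theta a b τ z := by
  rw [show z + τ = z + 1 / 2 * τ + 1 / 2 * τ by ring, theta_add_tau_half, theta_add_tau_half,
    ← theta_add_two_left a b τ z, ← mul_assoc, ← e_add, add_assoc]
  congr 2
  ring

/-- The substitution `m ↦ -a - m` negates `m + a/2`; the leftover phase `e(-bm)` is trivial. -/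
lemma theta_neg : theta a b τ (-z) = e (-(a * b) / 2) * theta a b τ z := by
  rw [theta_eq_tsum_e, theta_eq_tsum_e, ← tsum_mul_left]
  conv_lhs => rw [← (Equiv.subLeft (-a)).tsum_eq]
  refine tsum_congr fun m => ?_
  rw [Equiv.subLeft_apply, ← e_add, ← e_add_int (_ / _ + _) (-(b * m))]
  congr 1
  push_cast
  ring

lemma theta_one_one_neg : theta 1 1 τ (-z) = -theta 1 1 τ z := by
  rw [theta_neg, show (-((1 : ℤ) * (1 : ℤ)) / 2 : ℂ) = -(1 / 2) by norm_num, e_neg, e_half]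
  ring

lemma theta_zero_right_neg : theta a 0 τ (-z) = theta a 0 τ z := by
  rw [theta_neg, Int.cast_zero, mul_zero, neg_zero, zero_div, e_zero, one_mul]

lemma theta_zero_left_neg : theta 0 b τ (-z) = theta 0 b τ z := by
  rw [theta_neg, Int.cast_zero, zero_mul, neg_zero, zero_div, e_zero, one_mul]

lemma theta_one_one_zero : theta 1 1 τ 0 = 0 := by
  have h := theta_one_one_neg τ 0
  rw [neg_zero] at h
  exact self_eq_neg.1 h

lemma theta_add_int_add_int_mul_eq_zero (m : ℤ) (n : ℤ) (h : theta a b τ z = 0) :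
    theta a b τ (z + m + n * τ) = 0 := by
  have h1 : ∀ u, theta a b τ (u + 1) = 0 ↔ theta a b τ u = 0 := fun u => by
    rw [theta_add_one]; simp [e_ne_zero]
  have h2 : ∀ u, theta a b τ (u + τ) = 0 ↔ theta a b τ u = 0 := fun u => by
    rw [theta_add_tau]; simp [e_ne_zero]
  have h3 : theta a b τ (z + m) = 0 := by
    induction m with
    | zero => simpa using h
    | succ k ih => rw [← h1] at ih; convert ih using 2; push_cast; ring
    | pred k ih => rw [← h1]; convert ih using 2; push_cast; ring
  induction n with
  | zero => simpa using h3
  | succ k ih => rw [← h2] at ih; convert ih using 2; push_cast; ring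
  | pred k ih => rw [← h2]; convert ih using 2; push_cast; ring

end Shifts

/-! ### Product expansions, zeros of `ϑ₁₁`, and its derivative at `0`. -/

section Products

variable {τ : ℂ}

lemma differentiable_theta (hτ : 0 < τ.im) (a b : ℤ) : Differentiable ℂ (theta a b τ) := by
  intro z
  have h1 : DifferentiableAt ℂ (fun z : ℂ => jacobiTheta₂ (z + b / 2 + a / 2 * τ) τ) z :=
    (differentiableAt_jacobiTheta₂_fst _ hτ).comp z (by fun_prop)
  have h2 : DifferentiableAt ℂ (fun z : ℂ => e ((a : ℂ) ^ 2 / 8 * τ + a / 2 * (z + b / 2))) z :=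
    differentiable_e.differentiableAt.comp z (by fun_prop)
  exact (h2.mul h1).congr_of_eventuallyEq
    (Eventually.of_forall fun z => theta_eq_jacobiTheta₂ a b τ z)

lemma norm_e_half_mul_lt_one (hτ : 0 < τ.im) : ‖e (1 / 2 * τ)‖ < 1 := by
  rw [norm_e, Real.exp_lt_one_iff]
  have : (1 / 2 * τ).im = 1 / 2 * τ.im := by simp
  rw [this]
  have := Real.pi_pos
  simp only [Left.neg_neg_iff]
  positivity

lemma e_half_mul_sq : e (1 / 2 * τ) ^ 2 = e τ := by
  rw [sq, ← e_add]
  congr 1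
  ring

lemma norm_e_lt_one (hτ : 0 < τ.im) : ‖e τ‖ < 1 := by
  rw [← e_half_mul_sq, norm_pow]
  exact pow_lt_one₀ (norm_nonneg _) (norm_e_half_mul_lt_one hτ) two_ne_zero

theorem jacobiTheta₂_eq_qProd (hτ : 0 < τ.im) (z : ℂ) :
    jacobiTheta₂ z τ = qProd (e τ) (-e τ) * qProd (e τ) (e (1 / 2 * τ + z))
      * qProd (e τ) (e (1 / 2 * τ - z)) := by
  have hterm : ∀ j : ℤ, jacobiTheta₂_term j z τ = e (1 / 2 * τ) ^ (j ^ 2) * e z ^ j := fun j => by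
    rw [jacobiTheta₂_term_eq_e, ← e_int_mul, ← e_int_mul, ← e_add]
    congr 1
    push_cast
    ring
  have hs := (summable_jacobiTheta₂_term_iff z τ).2 hτ
  rw [jacobiTheta₂]
  simp only [hterm] at hs ⊢
  rw [tsum_zpow_sq_mul_zpow (norm_e_half_mul_lt_one hτ) (e_ne_zero _) (e_ne_zero _) hs,
    e_half_mul_sq, ← e_add, ← e_neg, ← e_add, sub_eq_add_neg]

/-- The factor `1 - e(-z)` is split off since it alone carries the zero at the origin. -/
lemma theta_one_one_eq_qProd (hτ : 0 < τ.im) (z : ℂ) :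
    theta 1 1 τ z = Complex.I * e (1 / 8 * τ + 1 / 2 * z) * (1 - e (-z)) * (qProd (e τ) (-e τ)
      * qProd (e τ) (-e (z + τ)) * qProd (e τ) (-e (-z + τ))) := by
  have h1 : e (1 / 2 * τ + (z + (1 : ℤ) / 2 + (1 : ℤ) / 2 * τ)) = -e (z + τ) := by
    rw [← neg_one_mul, ← e_half, ← e_add]
    congr 1
    push_cast
    ring
  have h2 : e (1 / 2 * τ - (z + (1 : ℤ) / 2 + (1 : ℤ) / 2 * τ)) = -e (-z) := by
    rw [← neg_one_mul, ← inv_neg_one, ← e_half, ← e_neg, ← e_add]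
    congr 1
    push_cast
    ring
  have h3 : e (((1 : ℤ) : ℂ) ^ 2 / 8 * τ + (1 : ℤ) / 2 * (z + (1 : ℤ) / 2))
      = Complex.I * e (1 / 8 * τ + 1 / 2 * z) := by
    rw [← e_quarter, ← e_add]
    congr 1
    push_cast
    ring
  rw [theta_eq_jacobiTheta₂, jacobiTheta₂_eq_qProd hτ, h1, h2, h3,
    qProd_eq_mul (norm_e_lt_one hτ) (-e (-z)), neg_mul, ← e_add]
  ring

/-- Up to units, the `z`-dependent factors of the product are precisely the denominators `1 - e(z)
q^j`. -/
theorem theta_one_one_ne_zero (hτ : 0 < τ.im) {z : ℂ} (h : ∀ j : ℤ, 1 - e (z + j * τ) ≠ 0) :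
    theta 1 1 τ z ≠ 0 := by
  have hq := norm_e_lt_one hτ
  have hn : ∀ n : ℕ, e τ ^ n = e (n * τ) := fun n => by
    rw [← zpow_natCast, ← e_int_mul]
    simp
  have hneg : ∀ u : ℂ, 1 - e u ≠ 0 → 1 - e (-u) ≠ 0 := fun u hu h0 => by
    refine hu ?_
    rw [e_neg, sub_eq_zero, eq_comm, inv_eq_one] at h0
    rw [h0, sub_self]
  rw [theta_one_one_eq_qProd hτ]
  refine mul_ne_zero (mul_ne_zero (mul_ne_zero Complex.I_ne_zero (e_ne_zero _)) ?_)
    (mul_ne_zero (mul_ne_zero (qProd_neg_self_ne_zero hq) ?_) ?_)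
  · exact hneg z (by simpa using h 0)
  · refine qProd_ne_zero hq fun n => ?_
    have h1 := h (n + 1)
    rw [hn, neg_mul, ← sub_eq_add_neg, ← e_add]
    convert h1 using 3
    push_cast
    ring
  · refine qProd_ne_zero hq fun n => ?_
    have h1 := hneg _ (h (-(n + 1)))
    rw [hn, neg_mul, ← sub_eq_add_neg, ← e_add]
    convert h1 using 3
    push_cast
    ring

theorem theta_one_one_eq_zero_iff (hτ : 0 < τ.im) (z : ℂ) :
    theta 1 1 τ z = 0 ↔ ∃ m n : ℤ, z = m + n * τ := by
  constructor
  · intro h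
    by_contra! hne
    refine theta_one_one_ne_zero hτ (fun j hj => ?_) h
    rw [sub_eq_zero, eq_comm, e_eq_one_iff] at hj
    obtain ⟨m, hm⟩ := hj
    refine hne m (-j) ?_
    push_cast
    linear_combination hm
  · rintro ⟨m, n, rfl⟩
    simpa using theta_add_int_add_int_mul_eq_zero 1 1 τ 0 m n (theta_one_one_zero τ)

lemma one_sub_e_ne_zero (hτ : 0 < τ.im) {z : ℂ} (hz : theta 1 1 τ z ≠ 0) (j : ℤ) :
    1 - e (z + j * τ) ≠ 0 := by
  intro h
  rw [sub_eq_zero, eq_comm, e_eq_one_iff] at h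
  obtain ⟨m, hm⟩ := h
  refine hz ((theta_one_one_eq_zero_iff hτ z).2 ⟨m, -j, ?_⟩)
  push_cast
  linear_combination hm

lemma theta_zero_mul_theta_zero_mul_theta_zero (hτ : 0 < τ.im) :
    theta 0 0 τ 0 * theta 0 1 τ 0 * theta 1 0 τ 0
      = 2 * e (1 / 8 * τ) * qProd (e τ) (-e τ) ^ 3 := by
  have hq := norm_e_lt_one hτ
  have h00 : theta 0 0 τ 0 = qProd (e τ) (-e τ) * qProd (e τ) (e (1 / 2 * τ)) ^ 2 := by
    rw [theta_eq_jacobiTheta₂, jacobiTheta₂_eq_qProd hτ]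
    simp [e_zero]
    ring
  have h01 : theta 0 1 τ 0 = qProd (e τ) (-e τ) * qProd (e τ) (-e (1 / 2 * τ)) ^ 2 := by
    have h1 : e (1 / 2 * τ + 1 / 2) = -e (1 / 2 * τ) := by
      rw [e_add, e_half]; ring
    have h2 : e (1 / 2 * τ - 1 / 2) = -e (1 / 2 * τ) := by
      rw [sub_eq_add_neg, e_add, e_neg, e_half]; norm_num
    rw [theta_eq_jacobiTheta₂, jacobiTheta₂_eq_qProd hτ]
    rw [show (0 + ((1 : ℤ) : ℂ) / 2 + ((0 : ℤ) : ℂ) / 2 * τ) = 1 / 2 by push_cast; ring, h1, h2]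
    simp [e_zero]
    ring
  have h10 : theta 1 0 τ 0
      = e (1 / 8 * τ) * qProd (e τ) (-e τ) * (2 * qProd (e τ) (e τ) ^ 2) := by
    rw [theta_eq_jacobiTheta₂, jacobiTheta₂_eq_qProd hτ,
      show (0 + ((0 : ℤ) : ℂ) / 2 + ((1 : ℤ) : ℂ) / 2 * τ) = 1 / 2 * τ by push_cast; ring,
      sub_self, e_zero, ← add_mul, add_halves, one_mul, qProd_eq_mul hq 1, one_mul,
      show (((1 : ℤ) : ℂ) ^ 2 / 8 * τ + ((1 : ℤ) : ℂ) / 2 * (0 + ((0 : ℤ) : ℂ) / 2)) = 1 / 8 * τ by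
        push_cast; ring]
    ring
  have h := qProd_mul_qProd_mul_qProd (norm_e_half_mul_lt_one hτ)
  rw [e_half_mul_sq] at h
  rw [h00, h01, h10]
  -- Euler's identity `P = 1` is needed in the form `P² = 1`; the cofactor is `P + 1`.
  linear_combination 2 * e (1 / 8 * τ) * qProd (e τ) (-e τ) ^ 3 *
    (qProd (e τ) (e (1 / 2 * τ)) * qProd (e τ) (-e (1 / 2 * τ)) * qProd (e τ) (e τ) + 1) * h

lemma theta_zero_mul_ne_zero (hτ : 0 < τ.im) :
    theta 0 0 τ 0 * theta 0 1 τ 0 * theta 1 0 τ 0 ≠ 0 := by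
  rw [theta_zero_mul_theta_zero_mul_theta_zero hτ]
  exact mul_ne_zero (mul_ne_zero two_ne_zero (e_ne_zero _))
    (pow_ne_zero _ (qProd_neg_self_ne_zero (norm_e_lt_one hτ)))

/-- **Jacobi's derivative formula** `ϑ₁₁'(0) = -π ϑ₀₀(0) ϑ₀₁(0) ϑ₁₀(0)`. -/
theorem tendsto_theta_one_one_div (hτ : 0 < τ.im) :
    Tendsto (fun z => theta 1 1 τ z / z) (𝓝[≠] 0)
      (𝓝 (-Real.pi * (theta 0 0 τ 0 * theta 0 1 τ 0 * theta 1 0 τ 0))) := by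
  have hcont : Continuous fun z => Complex.I * e (1 / 8 * τ + 1 / 2 * z) * -e (-z)
      * (qProd (e τ) (-e τ) * qProd (e τ) (-e (z + τ)) * qProd (e τ) (-e (-z + τ))) := by
    have h1 := continuous_qProd (norm_e_lt_one hτ)
    have h2 := differentiable_e.continuous
    fun_prop
  have hlim := ((hcont.tendsto 0).mono_left nhdsWithin_le_nhds).mul tendsto_one_sub_e_div
  rw [theta_zero_mul_theta_zero_mul_theta_zero hτ]
  convert hlim.congr fun z => ?_ using 2
  · simp only [mul_zero, add_zero, neg_zero, zero_add, e_zero]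
    linear_combination (-2 * Real.pi * e (1 / 8 * τ) * qProd (e τ) (-e τ) ^ 3) * Complex.I_sq
  · rw [theta_one_one_eq_qProd hτ]
    have h : -e (-z) * (1 - e z) = 1 - e (-z) := by
      have := e_add (-z) z
      rw [neg_add_cancel, e_zero] at this
      linear_combination -this
    rw [← h]
    ring

end Products

/-! ### Rigidity of odd quasi-periodic functions. -/

section Liouville

variable {τ : ℂ}

/-- By the identity theorem, it suffices that `ϑ₁₁` is nonzero at `1/2`, which lies outside `ℤ +
ℤτ`. -/
lemma eventually_theta_one_one_ne_zero (hτ : 0 < τ.im) (z : ℂ) :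
    ∀ᶠ y in 𝓝[≠] z, theta 1 1 τ y ≠ 0 := by
  have han : AnalyticOnNhd ℂ (theta 1 1 τ) Set.univ :=
    (differentiable_theta hτ 1 1).differentiableOn.analyticOnNhd isOpen_univ
  refine ((han z trivial).eventually_eq_zero_or_eventually_ne_zero).resolve_left fun h => ?_
  have hzero := han.eqOn_zero_of_preconnected_of_eventuallyEq_zero isPreconnected_univ trivial h
  obtain ⟨m, n, hmn⟩ := (theta_one_one_eq_zero_iff hτ (1 / 2)).1 (hzero trivial)
  have him := congrArg Complex.im hmn
  simp at him
  rcases him with him | him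
  · have hre := congrArg Complex.re hmn
    simp [him] at hre
    have h2 : (1 : ℝ) = ((2 * m : ℤ) : ℝ) := by push_cast; linarith
    have h3 : (1 : ℤ) = 2 * m := by exact_mod_cast h2
    omega
  · exact hτ.ne' him

lemma tendsto_sub_const_nhdsNE (z c : ℂ) :
    Tendsto (fun u => u - c) (𝓝[≠] (z + c)) (𝓝[≠] z) := by
  refine tendsto_nhdsWithin_iff.2 ⟨?_, ?_⟩
  · have h : Continuous fun u : ℂ => u - c := by fun_prop
    have := (h.tendsto (z + c)).mono_left (nhdsWithin_le_nhds (s := {z + c}ᶜ))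
    rwa [add_sub_cancel_right] at this
  · filter_upwards [self_mem_nhdsWithin] with u hu h
    exact hu (by rw [Set.mem_singleton_iff] at h ⊢; rw [← h, sub_add_cancel])

/-- A function with a removable singularity at `0`, odd near `0`, is `O(z)` there. -/
lemma exists_tendsto_div_of_odd {D : ℂ → ℂ} (hd : ∀ᶠ z in 𝓝[≠] 0, DifferentiableAt ℂ D z)
    (hodd : ∀ z, D (-z) = -D z) (h0 : Tendsto (fun z => z * D z) (𝓝[≠] 0) (𝓝 0)) :
    ∃ l, Tendsto (fun z => D z / z) (𝓝[≠] 0) (𝓝 l) := by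
  -- Oddness forces both the assigned value `D 0` and the limit at `0` to vanish, so `D` is already
  -- continuous there and `D z / z` tends to its derivative.
  have hD0 : D 0 = 0 := by
    have := hodd 0
    rw [neg_zero] at this
    exact self_eq_neg.1 this
  have hlim := Complex.tendsto_limUnder_of_differentiable_on_punctured_nhds_of_isLittleO hd (by
    rw [Asymptotics.isLittleO_iff_tendsto']
    · refine h0.congr fun z => ?_
      rw [hD0, sub_zero, sub_zero, div_inv_eq_mul, mul_comm]
    · filter_upwards [self_mem_nhdsWithin] with z hz h
      rw [sub_zero, inv_eq_zero] at h
      exact absurd h hz)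
  set L := limUnder (𝓝[≠] 0) D
  have hneg : Tendsto (fun z : ℂ => -z) (𝓝[≠] 0) (𝓝[≠] 0) := by
    refine tendsto_nhdsWithin_iff.2 ⟨?_, ?_⟩
    · have := ((continuous_neg (G := ℂ)).tendsto 0).mono_left (nhdsWithin_le_nhds (s := {0}ᶜ))
      rwa [neg_zero] at this
    · filter_upwards [self_mem_nhdsWithin] with z hz
      simpa using hz
  have hL : L = 0 := by
    have h1 : Tendsto (fun z => -D z) (𝓝[≠] 0) (𝓝 L) :=
      (hlim.comp hneg).congr fun z => hodd z
    exact self_eq_neg.1 (tendsto_nhds_unique h1 hlim.neg)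
  rw [hL] at hlim
  have hcont : ContinuousAt D 0 := by
    rw [continuousAt_iff_punctured_nhds, hD0]
    exact hlim
  have hdiff :=
    (Complex.analyticAt_of_differentiable_on_punctured_nhds_of_continuousAt hd hcont).differentiableAt
  refine ⟨deriv D 0, (hasDerivAt_iff_tendsto_slope_zero.1 hdiff.hasDerivAt).congr fun z => ?_⟩
  rw [zero_add, hD0, sub_zero, smul_eq_mul, div_eq_inv_mul]

lemma norm_add_int_add_int_mul_of_periodic {G : ℂ → ℂ} (h1 : ∀ z, ‖G (z + 1)‖ = ‖G z‖)
    (h2 : ∀ z, ‖G (z + τ)‖ = ‖G z‖) (m n : ℤ) (z : ℂ) : ‖G (z + m + n * τ)‖ = ‖G z‖ := by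
  have p1 : Function.Periodic (fun z => ‖G z‖) 1 := h1
  have p2 : Function.Periodic (fun z => ‖G z‖) τ := h2
  have e1 := p1.int_mul m z
  have e2 := p2.int_mul n (z + m)
  simp only [mul_one] at e1
  exact e2.trans e1

/-- Every point is a lattice translate of one in the compact parallelogram spanned by `1` and `τ`.
-/
lemma exists_norm_le_of_periodic (hτ : 0 < τ.im) {G : ℂ → ℂ} (hG : Continuous G)
    (h1 : ∀ z, ‖G (z + 1)‖ = ‖G z‖) (h2 : ∀ z, ‖G (z + τ)‖ = ‖G z‖) :
    ∃ C, ∀ z, ‖G z‖ ≤ C := by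
  have hK : IsCompact ((fun p : ℝ × ℝ => (p.1 + p.2 * τ : ℂ)) ''
      (Set.Icc (0 : ℝ) 1 ×ˢ Set.Icc (0 : ℝ) 1)) :=
    (isCompact_Icc.prod isCompact_Icc).image (by fun_prop)
  obtain ⟨C, hC⟩ := hK.exists_bound_of_continuousOn hG.continuousOn
  refine ⟨C, fun z => ?_⟩
  set b := z.im / τ.im
  set a := z.re - b * τ.re
  have hz : z = Int.fract a + Int.fract b * τ + ⌊a⌋ + ⌊b⌋ * τ := by
    have ha : ((Int.fract a : ℝ) : ℂ) = a - ⌊a⌋ := by rw [Int.fract]; push_cast; ring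
    have hb : ((Int.fract b : ℝ) : ℂ) = b - ⌊b⌋ := by rw [Int.fract]; push_cast; ring
    rw [ha, hb, show ((a : ℂ) - ⌊a⌋ + (b - ⌊b⌋) * τ + ⌊a⌋ + ⌊b⌋ * τ) = a + b * τ by ring]
    apply Complex.ext
    · simp [a]
    · simp [b, hτ.ne']
  rw [hz, norm_add_int_add_int_mul_of_periodic h1 h2]
  exact hC _ ⟨(Int.fract a, Int.fract b), ⟨⟨Int.fract_nonneg _, (Int.fract_lt_one _).le⟩,
    ⟨Int.fract_nonneg _, (Int.fract_lt_one _).le⟩⟩, rfl⟩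

/-- An odd function, holomorphic off the zeros of `ϑ₁₁`, with at most removable singularities there
and the quasi-periodicity of an (even) theta function of degree one, vanishes. -/
theorem eq_zero_of_odd_of_quasiperiodic (hτ : 0 < τ.im) {D : ℂ → ℂ} {ε : ℂ} (hε : ‖ε‖ = 1)
    (hd : ∀ z, theta 1 1 τ z ≠ 0 → DifferentiableAt ℂ D z)
    (hodd : ∀ z, D (-z) = -D z)
    (hone : ∀ z, D (z + 1) = ε * D z)
    (htau : ∀ z, D (z + τ) = e (-z - 1 / 2 * τ) * D z)
    (h0 : Tendsto (fun z => z * D z) (𝓝[≠] 0) (𝓝 0)) {z : ℂ} (hz : theta 1 1 τ z ≠ 0) :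
    D z = 0 := by
  have hloc := eventually_theta_one_one_ne_zero hτ
  have hθ := differentiable_theta hτ 1 1
  -- Dividing by `ϑ₁₁` leaves the constant multipliers `-ε` and `-1`, both of modulus one.
  set g : ℂ → ℂ := fun z => D z / theta 1 1 τ z with hg
  have g1 : ∀ z, g (z + 1) = -ε * g z := fun z => by
    simp only [hg, hone, theta_add_one, Int.cast_one, e_half]
    rw [neg_one_mul, div_neg]
    ring
  have gτ : ∀ z, g (z + τ) = -g z := fun z => by
    have he : e (-z - ((1 : ℤ) : ℂ) / 2 - 1 / 2 * τ) = -e (-z - 1 / 2 * τ) := by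
      rw [← e_sub_half]
      congr 1
      push_cast
      ring
    simp only [hg, htau, theta_add_tau, he]
    rw [neg_mul, div_neg, mul_div_mul_left _ _ (e_ne_zero _)]
  have gdiff : ∀ z, theta 1 1 τ z ≠ 0 → DifferentiableAt ℂ g z := fun z hz =>
    (hd z hz).div (hθ z) hz
  have hzero : ∃ l, Tendsto g (𝓝[≠] 0) (𝓝 l) := by
    obtain ⟨l, hl⟩ := exists_tendsto_div_of_odd ((hloc 0).mono hd) hodd h0
    refine ⟨_, (hl.div (tendsto_theta_one_one_div hτ) ?_).congr' ?_⟩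
    · exact mul_ne_zero (neg_ne_zero.2 (by exact_mod_cast Real.pi_ne_zero))
        (theta_zero_mul_ne_zero hτ)
    · filter_upwards [self_mem_nhdsWithin] with z hz
      exact div_div_div_cancel_right₀ hz _ _
  have shift : ∀ c κ : ℂ, (∀ z, g (z + c) = κ * g z) → ∀ z l, Tendsto g (𝓝[≠] z) (𝓝 l) →
      Tendsto g (𝓝[≠] (z + c)) (𝓝 (κ * l)) := fun c κ h z l hl => by
    refine ((hl.comp (tendsto_sub_const_nhdsNE z c)).const_mul κ).congr fun u => ?_
    rw [Function.comp_apply, ← h, sub_add_cancel]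
  have hε0 : -ε ≠ 0 := neg_ne_zero.2 (norm_ne_zero_iff.1 (by rw [hε]; exact one_ne_zero))
  have g1' : ∀ z, g (z + -1) = (-ε)⁻¹ * g z := fun z => by
    rw [eq_inv_mul_iff_mul_eq₀ hε0, ← g1]
    congr 1
    ring
  have gτ' : ∀ z, g (z + τ) = -1 * g z := fun z => by rw [gτ]; ring
  have gτ'' : ∀ z, g (z + -τ) = -1 * g z := fun z => by
    have := gτ (z + -τ)
    rw [neg_add_cancel_right] at this
    rw [this]
    ring
  -- The limit at `0` is carried to every lattice point by the multipliers; elsewhere `g` is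
  -- continuous.
  have hlim : ∀ z, ∃ l, Tendsto g (𝓝[≠] z) (𝓝 l) := by
    intro z
    by_cases hz : theta 1 1 τ z = 0
    · obtain ⟨m, n, rfl⟩ := (theta_one_one_eq_zero_iff hτ z).1 hz
      have h3 : ∃ l, Tendsto g (𝓝[≠] (m : ℂ)) (𝓝 l) := by
        clear hz
        induction m with
        | zero => simpa using hzero
        | succ k ih =>
          obtain ⟨l, hl⟩ := ih
          exact ⟨_, by simpa using shift 1 _ g1 _ l hl⟩
        | pred k ih =>
          obtain ⟨l, hl⟩ := ih
          exact ⟨_, by simpa [sub_eq_add_neg] using shift (-1) _ g1' _ l hl⟩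
      clear hz
      induction n with
      | zero => simpa using h3
      | succ k ih =>
        obtain ⟨l, hl⟩ := ih
        refine ⟨-1 * l, ?_⟩
        rw [show ((m : ℂ) + ((k + 1 : ℤ) : ℂ) * τ) = m + (k : ℤ) * τ + τ by push_cast; ring]
        exact shift τ _ gτ' _ l hl
      | pred k ih =>
        obtain ⟨l, hl⟩ := ih
        refine ⟨-1 * l, ?_⟩
        rw [show ((m : ℂ) + ((-k - 1 : ℤ) : ℂ) * τ) = m + (-k : ℤ) * τ + -τ by push_cast; ring]
        exact shift (-τ) _ gτ'' _ l hl
    · exact ⟨g z, (gdiff z hz).continuousAt.tendsto.mono_left nhdsWithin_le_nhds⟩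
  -- `G` is the entire extension of `g`. It is bounded, hence constant, and the multiplier `-1` of
  -- `τ` makes the constant zero.
  choose G hG using hlim
  have hGg : ∀ z, theta 1 1 τ z ≠ 0 → G z = g z := fun z hz =>
    tendsto_nhds_unique (hG z) ((gdiff z hz).continuousAt.tendsto.mono_left nhdsWithin_le_nhds)
  have hGdiff : Differentiable ℂ G := by
    intro z
    refine (Complex.analyticAt_of_differentiable_on_punctured_nhds_of_continuousAt
      ?_ ?_).differentiableAt
    · filter_upwards [hloc z] with y hy
      refine (gdiff y hy).congr_of_eventuallyEq ?_
      filter_upwards [hθ.continuous.continuousAt.eventually_ne hy] with u hu using hGg u hu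
    · rw [continuousAt_iff_punctured_nhds]
      refine (hG z).congr' ?_
      filter_upwards [hloc z] with y hy using (hGg y hy).symm
  have G1 : ∀ z, G (z + 1) = -ε * G z := fun z =>
    tendsto_nhds_unique (hG (z + 1)) (shift 1 _ g1 z _ (hG z))
  have Gτ : ∀ z, G (z + τ) = -1 * G z := fun z =>
    tendsto_nhds_unique (hG (z + τ)) (shift τ _ gτ' z _ (hG z))
  obtain ⟨C, hC⟩ := exists_norm_le_of_periodic hτ hGdiff.continuous
    (fun z => by rw [G1, norm_mul, norm_neg, hε, one_mul])
    (fun z => by rw [Gτ, norm_mul, norm_neg, norm_one, one_mul])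
  have hconst := hGdiff.apply_eq_apply_of_bounded
    (isBounded_iff_forall_norm_le.2 ⟨C, by rintro _ ⟨z, rfl⟩; exact hC z⟩)
  have hGz : G z = 0 := by
    have := Gτ z
    rw [hconst (z + τ) z, neg_one_mul] at this
    exact self_eq_neg.1 this
  rw [hGg z hz] at hGz
  exact (div_eq_zero_iff.1 hGz).resolve_right hz

end Liouville

/-! ### The Appell sum and its symmetries. -/

/-- The general term of the Appell sum `appell s τ z`. -/
def appellTerm (s τ : ℂ) (j : ℤ) (z : ℂ) : ℂ :=
  e ((j + s) * z + ((j : ℂ) ^ 2 / 2 + s * j) * τ) / (1 - e (z + j * τ))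

/-- The Appell sum `∑_j e((j + s) z) q^{j²/2 + s j} / (1 - e(z) q^j)`. -/
def appell (s τ z : ℂ) : ℂ := ∑' j : ℤ, appellTerm s τ j z

section Symmetries

variable (s τ z : ℂ)

/-- Replace `j` by `-j` and multiply numerator and denominator by `e(z + jτ)`. This also holds at
the poles, where a term with zero denominator counts as `0` on both sides. -/
lemma appell_neg : appell s τ (-z) = -appell (1 - s) τ z := by
  rw [appell, appell, ← tsum_neg]
  conv_lhs => rw [← (Equiv.neg ℤ).tsum_eq]
  refine tsum_congr fun j => ?_
  rw [appellTerm, appellTerm, Equiv.neg_apply]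
  have h1 : 1 - e (-z + ((-j : ℤ) : ℂ) * τ) = -((1 - e (z + j * τ)) / e (z + j * τ)) := by
    rw [show -z + ((-j : ℤ) : ℂ) * τ = -(z + j * τ) by push_cast; ring, e_neg]
    field_simp [e_ne_zero]
    ring
  have h2 : e ((j + (1 - s)) * z + ((j : ℂ) ^ 2 / 2 + (1 - s) * j) * τ)
      = e ((((-j : ℤ) : ℂ) + s) * -z + ((((-j : ℤ) : ℂ)) ^ 2 / 2 + s * ((-j : ℤ) : ℂ)) * τ)
        * e (z + j * τ) := by
    rw [← e_add]
    congr 1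
    push_cast
    ring
  rw [h1, h2, div_neg, div_div_eq_mul_div]

lemma appell_add_tau : appell s τ (z + τ) = e (-z - 1 / 2 * τ) * appell s τ z := by
  rw [appell, appell, ← tsum_mul_left]
  conv_rhs => rw [← (Equiv.addRight (1 : ℤ)).tsum_eq]
  refine tsum_congr fun j => ?_
  rw [appellTerm, appellTerm, Equiv.coe_addRight, ← mul_div_assoc, ← e_add,
    show z + τ + j * τ = z + ((j + 1 : ℤ) : ℂ) * τ by push_cast; ring]
  refine congrArg (e · / _) ?_
  push_cast
  ring

lemma appell_add_one : appell s τ (z + 1) = e s * appell s τ z := by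
  rw [appell, appell, ← tsum_mul_left]
  refine tsum_congr fun j => ?_
  rw [appellTerm, appellTerm, ← mul_div_assoc, ← e_add, ← e_add_int (s + _) j,
    show z + 1 + j * τ = z + j * τ + (1 : ℤ) by push_cast; ring, e_add_int]
  congr 2
  ring

end Symmetries

/-! ### Convergence, holomorphy and residue of the Appell sum. -/

section Convergence

variable {τ : ℂ}

lemma half_le_norm_one_sub_e {u : ℂ} (hu : 1 ≤ |u.im|) : 1 / 2 ≤ ‖1 - e u‖ := by
  have hpi := Real.pi_gt_three
  have h2 : (2 : ℝ) ≤ Real.exp 1 := by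
    have := Real.add_one_le_exp (1 : ℝ)
    linarith
  rcases le_abs'.1 hu with h | h
  · have h3 : (2 : ℝ) ≤ ‖e u‖ := by
      rw [norm_e]
      refine h2.trans (Real.exp_le_exp.2 ?_)
      nlinarith
    have := norm_sub_norm_le (e u) 1
    rw [norm_one, norm_sub_rev] at this
    linarith
  · have h3 : ‖e u‖ ≤ 1 / 2 := by
      rw [norm_e]
      refine (Real.exp_le_exp.2 (show -(2 * Real.pi * u.im) ≤ -1 by nlinarith)).trans ?_
      rw [Real.exp_neg, one_div]
      exact inv_anti₀ two_pos h2
    have := norm_sub_norm_le 1 (e u)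
    rw [norm_one] at this
    linarith

lemma exists_eventually_norm_inv_one_sub_e_le (hτ : 0 < τ.im) (J : Set ℤ) {z₀ : ℂ}
    (h : ∀ j ∈ J, 1 - e (z₀ + j * τ) ≠ 0) :
    ∃ C : ℤ → ℝ, (∀ j, 0 ≤ C j) ∧ (∀ᶠ j in cofinite, C j = 2) ∧ ∀ᶠ z in 𝓝 z₀, ∀ j ∈ J,
      1 - e (z + j * τ) ≠ 0 ∧ ‖(1 - e (z + j * τ))⁻¹‖ ≤ C j := by
  -- For `|j| ≥ N` and `z` within `1` of `z₀` this gives `|Im(z + jτ)| ≥ 1`: of the `2`, one unit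
  -- pays for moving `z`, the other remains. The finitely many other `j` are handled by continuity.
  obtain ⟨N, hN⟩ := exists_nat_ge ((|z₀.im| + 2) / τ.im)
  rw [div_le_iff₀ hτ] at hN
  have hfin : (Set.Icc (-N : ℤ) N).Finite := Set.finite_Icc _ _
  classical
  refine ⟨fun j => if j ∈ Set.Icc (-N : ℤ) N then ‖(1 - e (z₀ + j * τ))⁻¹‖ + 1 else 2, fun j => ?_,
    ?_, ?_⟩
  · dsimp only
    split_ifs <;> positivity
  · filter_upwards [hfin.compl_mem_cofinite] with j hj
    exact if_neg hj
  · have hcont : ∀ j : ℤ, Continuous fun z : ℂ => 1 - e (z + j * τ) := fun j => by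
      have := differentiable_e.continuous
      fun_prop
    have hsmall : ∀ᶠ z in 𝓝 z₀, ∀ j ∈ Set.Icc (-N : ℤ) N, j ∈ J →
        1 - e (z + j * τ) ≠ 0 ∧ ‖(1 - e (z + j * τ))⁻¹‖ ≤ ‖(1 - e (z₀ + j * τ))⁻¹‖ + 1 := by
      rw [eventually_all_finite hfin]
      intro j _
      by_cases hj : j ∈ J
      · have hc := (hcont j).continuousAt (x := z₀)
        have h1 := hc.eventually_ne (h j hj)
        have h2 := (hc.inv₀ (h j hj)).norm.eventually_lt_const
          (lt_add_one ‖(1 - e (z₀ + j * τ))⁻¹‖)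
        filter_upwards [h1, h2] with z h1 h2 _ using ⟨h1, h2.le⟩
      · exact Eventually.of_forall fun z hj' => absurd hj' hj
    filter_upwards [hsmall, Metric.ball_mem_nhds z₀ one_pos] with z hz hball j hj
    by_cases hjN : j ∈ Set.Icc (-N : ℤ) N
    · rw [if_pos hjN]
      exact hz j hjN hj
    · rw [if_neg hjN]
      have him : |z.im - z₀.im| ≤ 1 := by
        rw [← Complex.sub_im]
        exact (Complex.abs_im_le_norm _).trans (by
          rw [← dist_eq_norm]; exact (Metric.mem_ball.1 hball).le)
      have hjabs : (N : ℝ) ≤ |(j : ℝ)| := by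
        have : (N : ℤ) ≤ |j| := by
          rw [Set.mem_Icc, ← abs_le, not_le] at hjN
          exact hjN.le
        exact_mod_cast this
      have hu : 1 ≤ |(z + j * τ).im| := by
        have h1 : (z + j * τ).im = j * τ.im + ((z.im - z₀.im) + z₀.im) := by simp; ring
        have h2 : |(j : ℝ) * τ.im| = |(j : ℝ)| * τ.im := by rw [abs_mul, abs_of_pos hτ]
        have h3 := abs_sub_abs_le_abs_sub ((j : ℝ) * τ.im) (-((z.im - z₀.im) + z₀.im))
        have h4 := abs_add_le (z.im - z₀.im) z₀.im
        have h5 : (N : ℝ) * τ.im ≤ |(j : ℝ)| * τ.im := by gcongr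
        rw [abs_neg, sub_neg_eq_add] at h3
        rw [h1]
        linarith
      have hhalf := half_le_norm_one_sub_e hu
      refine ⟨norm_pos_iff.1 (by linarith), ?_⟩
      rw [norm_inv]
      have := inv_anti₀ (by norm_num) hhalf
      norm_num at this ⊢
      exact this

lemma appellTerm_eq (s τ : ℂ) (j : ℤ) (z : ℂ) :
    appellTerm s τ j z
      = e (s * z) * (jacobiTheta₂_term j (z + s * τ) τ * (1 - e (z + j * τ))⁻¹) := by
  rw [appellTerm, jacobiTheta₂_term_eq_e, ← mul_assoc, ← e_add, div_eq_mul_inv]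
  congr 2
  ring

/-- The part of the Appell sum over the indices in `J` converges and is holomorphic where none of
its denominators vanishes. -/
lemma summable_and_differentiableAt_indicator (hτ : 0 < τ.im) (s : ℂ) (J : Set ℤ) {z₀ : ℂ}
    (h : ∀ j ∈ J, 1 - e (z₀ + j * τ) ≠ 0) :
    (Summable fun j => J.indicator (fun j => appellTerm s τ j z₀) j) ∧
      DifferentiableAt ℂ (fun z => ∑' j, J.indicator (fun j => appellTerm s τ j z) j) z₀ := by
  obtain ⟨C, hC0, hC2, hC⟩ := exists_eventually_norm_inv_one_sub_e_le hτ J h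
  -- `S` bounds `|Im(z + sτ)|` on the unit ball about `z₀`, giving a Gaussian majorant uniform in
  -- `z`.
  set S := |z₀.im| + 1 + |(s * τ).im|
  set b : ℤ → ℝ := fun n => Real.exp (-Real.pi * (τ.im * n ^ 2 - 2 * S * |n|))
  have hb : Summable b := by
    simpa [b] using summable_pow_mul_jacobiTheta₂_term_bound S hτ 0
  have hu : Summable fun j => b j * C j := by
    refine (hb.mul_right 2).congr_cofinite ?_
    filter_upwards [hC2] with j hj
    rw [hj]
  obtain ⟨V, hV, hVo, hzV⟩ := eventually_nhds_iff.1 (hC.and (Metric.ball_mem_nhds z₀ one_pos))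
  let f : ℤ → ℂ → ℂ := fun j z => J.indicator (fun j =>
    jacobiTheta₂_term j (z + s * τ) τ * (1 - e (z + j * τ))⁻¹) j
  have hf : ∀ z j, J.indicator (fun j => appellTerm s τ j z) j = e (s * z) * f j z := by
    intro z j
    by_cases hj : j ∈ J
    · simp only [f, Set.indicator_of_mem hj, appellTerm_eq]
    · simp only [f, Set.indicator_of_notMem hj, mul_zero]
  have hbound : ∀ (j : ℤ) (z : ℂ), z ∈ V → ‖f j z‖ ≤ b j * C j := by
    intro j z hz
    obtain ⟨h1, hball⟩ := hV z hz
    by_cases hj : j ∈ J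
    · simp only [f, Set.indicator_of_mem hj]
      rw [norm_mul]
      refine mul_le_mul ?_ (h1 j hj).2 (norm_nonneg _) (Real.exp_pos _).le
      refine norm_jacobiTheta₂_term_le hτ ?_ le_rfl j
      have him : |z.im - z₀.im| ≤ 1 := by
        rw [← Complex.sub_im]
        exact (Complex.abs_im_le_norm _).trans (by
          rw [← dist_eq_norm]; exact (Metric.mem_ball.1 hball).le)
      have h3 := abs_sub_abs_le_abs_sub z.im z₀.im
      rw [Complex.add_im]
      exact (abs_add_le _ _).trans (add_le_add_left (by linarith) _)
    · simp only [f, Set.indicator_of_notMem hj, norm_zero]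
      exact mul_nonneg (Real.exp_pos _).le (hC0 j)
  have hdiff : ∀ j, DifferentiableOn ℂ (f j) V := by
    intro j
    by_cases hj : j ∈ J
    · simp only [f, Set.indicator_of_mem hj]
      have he := differentiable_e
      have h1 : Differentiable ℂ fun z : ℂ => jacobiTheta₂_term j (z + s * τ) τ := by
        simp only [jacobiTheta₂_term]
        fun_prop
      have h2 : Differentiable ℂ fun z : ℂ => 1 - e (z + j * τ) := by fun_prop
      exact h1.differentiableOn.mul
        (h2.differentiableOn.inv fun z hz => ((hV z hz).1 j hj).1)
    · simp only [f, Set.indicator_of_notMem hj]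
      exact differentiableOn_const _
  simp only [hf, tsum_mul_left]
  refine ⟨(Summable.of_norm_bounded hu fun j => hbound j z₀ hzV).mul_left _, ?_⟩
  refine DifferentiableAt.mul (differentiable_e.differentiableAt.comp z₀ (by fun_prop)) ?_
  exact (Complex.differentiableOn_tsum_of_summable_norm hu hdiff hVo hbound).differentiableAt
    (hVo.mem_nhds hzV)

lemma summable_appellTerm (hτ : 0 < τ.im) (s : ℂ) {z : ℂ} (hz : theta 1 1 τ z ≠ 0) :
    Summable fun j => appellTerm s τ j z := by
  have h := summable_and_differentiableAt_indicator hτ s Set.univ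
    (fun j _ => one_sub_e_ne_zero hτ hz j)
  simpa using h.1

lemma differentiableAt_appell (hτ : 0 < τ.im) (s : ℂ) {z : ℂ} (hz : theta 1 1 τ z ≠ 0) :
    DifferentiableAt ℂ (appell s τ) z := by
  have h := summable_and_differentiableAt_indicator hτ s Set.univ
    (fun j _ => one_sub_e_ne_zero hτ hz j)
  simp only [Set.indicator_univ] at h
  exact h.2

/-- Only the term `j = 0` is singular at the origin; the others form a holomorphic function there.
The residue does not depend on `s`. -/
lemma tendsto_mul_appell (hτ : 0 < τ.im) (s : ℂ) :
    Tendsto (fun z => z * appell s τ z) (𝓝[≠] 0) (𝓝 (-(2 * Real.pi * Complex.I))⁻¹) := by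
  have hrest := (summable_and_differentiableAt_indicator hτ s {0}ᶜ (z₀ := 0) (fun j hj hzero => by
    rw [sub_eq_zero, eq_comm, e_eq_one_iff] at hzero
    obtain ⟨n, hn⟩ := hzero
    have him := congrArg Complex.im hn
    simp [hτ.ne'] at him
    exact hj him)).2.continuousAt
  have h1 : Tendsto (fun z : ℂ => z * ∑' j, ({0}ᶜ : Set ℤ).indicator
      (fun j => appellTerm s τ j z) j) (𝓝[≠] 0) (𝓝 0) := by
    have := (continuousAt_id.mul hrest).tendsto.mono_left (nhdsWithin_le_nhds (s := {0}ᶜ))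
    rw [Pi.mul_apply, id_eq, zero_mul] at this
    exact this
  have h2 : Tendsto (fun z : ℂ => e (s * z) * ((1 - e z) / z)⁻¹) (𝓝[≠] 0)
      (𝓝 (-(2 * Real.pi * Complex.I))⁻¹) := by
    have hc : Continuous fun z : ℂ => e (s * z) := by
      have := differentiable_e.continuous
      fun_prop
    have := ((hc.tendsto 0).mono_left (nhdsWithin_le_nhds (s := {0}ᶜ))).mul
      (tendsto_one_sub_e_div.inv₀ (neg_ne_zero.2 Complex.two_pi_I_ne_zero))
    simpa [e_zero] using this
  have h3 := h2.add h1
  rw [add_zero] at h3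
  refine h3.congr' ?_
  filter_upwards [eventually_theta_one_one_ne_zero hτ 0] with z hz
  rw [appell, (summable_appellTerm hτ s hz).tsum_eq_add_tsum_ite 0, mul_add]
  congr 1
  · rw [appellTerm]
    simp
    ring
  · congr 1
    refine tsum_congr fun j => ?_
    by_cases hj : j = 0 <;> simp [hj]

end Convergence

/-! ### The symmetric combination `A_s + A_{1-s}`. -/

section Closed

variable {τ : ℂ}

/-- The symmetrised Appell sum is a theta quotient. -/
theorem appell_add_appell (hτ : 0 < τ.im) {a : ℤ} (ha : a = 0 ∨ a = 1) (n : ℤ) {z : ℂ}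
    (hz : theta 1 1 τ z ≠ 0) :
    appell (n + a / 2) τ z + appell (1 - (n + a / 2)) τ z
      = -Complex.I * theta a 0 τ 0 * (theta 0 1 τ z * theta (1 - a) 0 τ z / theta 1 1 τ z) := by
  set s : ℂ := n + a / 2 with hs
  have he : e (a / 2) = e s := by rw [hs, add_comm, e_add_int]
  -- Since `2s` is an integer, both Appell sums have the same multiplier under `z ↦ z + 1`.
  have he' : e (1 - s) = e s := by
    rw [← e_add_int (1 - s) (2 * n + a - 1), hs]
    congr 1
    push_cast
    ring
  refine sub_eq_zero.1 (eq_zero_of_odd_of_quasiperiodic hτ (D := fun z =>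
    (appell s τ z + appell (1 - s) τ z)
      - -Complex.I * theta a 0 τ 0 * (theta 0 1 τ z * theta (1 - a) 0 τ z / theta 1 1 τ z))
    (ε := e s) ?_ ?_ ?_ ?_ ?_ ?_ hz)
  · rw [norm_e]
    simp [hs]
  · intro z hz
    have h1 := differentiable_theta hτ
    exact ((differentiableAt_appell hτ s hz).add (differentiableAt_appell hτ (1 - s) hz)).sub
      (((((h1 0 1) z).mul (h1 (1 - a) 0 z)).div (h1 1 1 z) hz).const_mul _)
  · intro z
    simp only [appell_neg, theta_one_one_neg, theta_zero_right_neg, theta_zero_left_neg,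
      sub_sub_cancel, div_neg]
    ring
  · intro z
    have h1 : e (((1 - a : ℤ) : ℂ) / 2) = -e s := by
      rw [← he, ← e_sub_half, ← e_add_int (_ - _) (1 - a)]
      congr 1
      push_cast
      ring
    simp only [appell_add_one, theta_add_one, he', h1, Int.cast_one, Int.cast_zero, zero_div,
      e_zero, e_half, one_mul, div_neg, neg_mul, mul_neg]
    ring
  · intro z
    have h1 : e (-z - ((1 : ℤ) : ℂ) / 2 - 1 / 2 * τ) = -e (-z - 1 / 2 * τ) := by
      rw [← e_sub_half]
      congr 1
      push_cast
      ring
    have h2 : e (-z - ((0 : ℤ) : ℂ) / 2 - 1 / 2 * τ) = e (-z - 1 / 2 * τ) := by simp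
    simp only [appell_add_tau, theta_add_tau, h1, h2]
    have h3 := e_ne_zero (-z - 1 / 2 * τ)
    -- At a zero of `ϑ₁₁` the quotient is `0` by convention, and so is its translate.
    by_cases h0 : theta 1 1 τ z = 0
    · simp [h0]; ring
    · field_simp
  -- The residues agree: twice `-1/(2πi)` on one side, `-iP / (-πP)` on the other, with `P = ϑ₀₀(0)
  -- ϑ₀₁(0) ϑ₁₀(0)` for either parity `a`.
  · have hP := theta_zero_mul_ne_zero hτ
    have hpi : (Real.pi : ℂ) ≠ 0 := by exact_mod_cast Real.pi_ne_zero
    have h1 := (tendsto_mul_appell hτ s).add (tendsto_mul_appell hτ (1 - s))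
    have hc : Continuous fun z => -Complex.I * theta a 0 τ 0 * (theta 0 1 τ z * theta (1 - a) 0 τ z) :=
      by
        have h01 := (differentiable_theta hτ 0 1).continuous
        have h10 := (differentiable_theta hτ (1 - a) 0).continuous
        fun_prop
    have h2 := ((hc.tendsto 0).mono_left (nhdsWithin_le_nhds (s := {0}ᶜ))).div
      (tendsto_theta_one_one_div hτ) (mul_ne_zero (neg_ne_zero.2 hpi) hP)
    have hval : theta a 0 τ 0 * (theta 0 1 τ 0 * theta (1 - a) 0 τ 0)
        = theta 0 0 τ 0 * theta 0 1 τ 0 * theta 1 0 τ 0 := by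
      rcases ha with rfl | rfl
      · rw [sub_zero]; ring
      · rw [sub_self]; ring
    rw [mul_assoc, hval] at h2
    have h3 := h1.sub h2
    have hlim : (-(2 * Real.pi * Complex.I))⁻¹ + (-(2 * Real.pi * Complex.I))⁻¹
        - -Complex.I * (theta 0 0 τ 0 * theta 0 1 τ 0 * theta 1 0 τ 0)
          / (-Real.pi * (theta 0 0 τ 0 * theta 0 1 τ 0 * theta 1 0 τ 0)) = 0 := by
      have hI := Complex.I_ne_zero
      rw [mul_div_mul_right _ _ hP]
      field_simp
      rw [Complex.I_sq]
      ring
    rw [hlim] at h3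
    refine h3.congr fun z => ?_
    rw [Pi.div_apply, div_div_eq_mul_div]
    ring

end Closed

/-! ### The telescoping difference. -/

section Recursion

variable {τ : ℂ}

/-- Raising `s` by one multiplies the `j`-th numerator by `e(z + jτ)`, so the difference cancels the
denominator; completing the square yields the theta series. -/
lemma appell_sub_appell_add_one (hτ : 0 < τ.im) (c : ℤ) {z : ℂ} (hz : theta 1 1 τ z ≠ 0) :
    appell (c / 2) τ z - appell (c / 2 + 1) τ z
      = e (-(c / 2 : ℂ) ^ 2 / 2 * τ) * theta c 0 τ z := by
  rw [appell, appell, ← (summable_appellTerm hτ _ hz).tsum_sub (summable_appellTerm hτ _ hz),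
    theta_eq_tsum_e, ← tsum_mul_left]
  refine tsum_congr fun j => ?_
  have h1 : e ((j + (c / 2 + 1)) * z + ((j : ℂ) ^ 2 / 2 + (c / 2 + 1) * j) * τ)
      = e ((j + c / 2) * z + ((j : ℂ) ^ 2 / 2 + c / 2 * j) * τ) * e (z + j * τ) := by
    rw [← e_add]
    congr 1
    ring
  rw [appellTerm, appellTerm, h1, ← sub_div, ← mul_one_sub,
    mul_div_cancel_right₀ _ (one_sub_e_ne_zero hτ hz j), ← e_add]
  congr 1
  push_cast
  ring

lemma appell_sub_appell_add_nat (hτ : 0 < τ.im) (a n : ℤ) {z : ℂ} (hz : theta 1 1 τ z ≠ 0)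
    (m : ℕ) :
    appell (n + a / 2) τ z - appell (n + a / 2 + m) τ z
      = ∑ k ∈ Finset.range m, e (-(k + n + a / 2 : ℂ) ^ 2 / 2 * τ) * theta a 0 τ z := by
  induction m with
  | zero => simp
  | succ m ih =>
    have h := appell_sub_appell_add_one hτ (a + 2 * (m + n)) hz
    rw [theta_add_two_mul_left] at h
    rw [Finset.sum_range_succ, ← ih, ← sub_add_sub_cancel _ (appell (n + a / 2 + m) τ z)]
    congr 1
    convert h using 3 <;> push_cast <;> ring_nf

end Recursion

/-! ### The two master formulas. -/

section Formulas

variable {τ : ℂ}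

lemma hasSum_of_eq_mul {f g : ℤ → ℂ} {S c R : ℂ} (hf : HasSum f S)
    (hg : ∀ j, g j = c * f j) (hR : R = c * S) : HasSum g R := by
  rw [hR, funext hg]
  exact hf.mul_left c

/-- The series with denominators `1 - e(z) q^{j+n}`, for both parities `a` of twice the offset. -/
theorem hasSum_integral_shift (hτ : 0 < τ.im) {a : ℕ} (ha : a = 0 ∨ a = 1) (n : ℕ) {z : ℂ}
    (h : ∀ j : ℤ, 1 - e (z + (j + n) * τ) ≠ 0) :
    theta 1 1 τ z ≠ 0 ∧
      HasSum (fun j : ℤ => e ((j - a / 2) * z + (j - a / 2 : ℂ) ^ 2 / 2 * τ)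
          / (1 - e (z + (j + n) * τ)))
        (1 / 2 * e ((n + a / 2 : ℂ) ^ 2 / 2 * τ)
          * (-Complex.I * theta a 0 τ 0 * (theta 0 1 τ z * theta (1 - a) 0 τ z / theta 1 1 τ z)
            + ∑ k ∈ Finset.range (2 * n + 1 + a),
                e (-(k - n - a / 2 : ℂ) ^ 2 / 2 * τ) * theta a 0 τ z)) := by
  have hz : theta 1 1 τ z ≠ 0 := by
    refine theta_one_one_ne_zero hτ fun j => ?_
    convert h (j - n) using 3
    push_cast
    ring
  refine ⟨hz, ?_⟩
  -- The integer `-n - a` is chosen so that `s = -n - a + a/2 = -(n + a/2)`; then `2n + 1 + a` unit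
  -- steps lead from `s` to `1 - s`.
  have hclosed := appell_add_appell hτ (a := a) (by omega) (-n - a) hz
  have htel := appell_sub_appell_add_nat hτ a (-n - a) hz (2 * n + 1 + a)
  have hs1 : (((-n - a : ℤ) : ℂ) + ((a : ℤ) : ℂ) / 2) = -(n + a / 2) := by push_cast; ring
  have hs2 : -(n + a / 2 : ℂ) + ((2 * n + 1 + a : ℕ) : ℂ) = 1 - -(n + a / 2) := by push_cast; ring
  rw [hs1] at hclosed
  simp only [add_assoc ((_ : ℕ) : ℂ) ((_ : ℤ) : ℂ), hs1, hs2] at htel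
  have hsum := (summable_appellTerm hτ (-(n + a / 2)) hz).hasSum
  rw [← appell, ← (Equiv.addRight (n : ℤ)).hasSum_iff] at hsum
  refine hasSum_of_eq_mul (c := e ((n + a / 2 : ℂ) ^ 2 / 2 * τ)) hsum (fun j => ?_) ?_
  · rw [Function.comp_apply, Equiv.coe_addRight, appellTerm, ← mul_div_assoc, ← e_add]
    push_cast
    refine congrArg (e · / _) ?_
    ring
  · simp only [sub_sub, ← sub_eq_add_neg] at htel ⊢
    rw [sub_neg_eq_add] at htel hclosed
    rw [← htel]
    linear_combination (-(1 / 2) * e ((n + a / 2 : ℂ) ^ 2 / 2 * τ)) * hclosed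

/-- The series with denominators `1 - e(z) q^{j+n+1/2}`, for both parities `a`. -/
theorem hasSum_half_integral_shift (hτ : 0 < τ.im) {a : ℕ} (ha : a = 0 ∨ a = 1) (n : ℕ) {z : ℂ}
    (h : ∀ j : ℤ, 1 - e (z + (j + n + 1 / 2) * τ) ≠ 0) :
    theta 0 1 τ z ≠ 0 ∧
      HasSum (fun j : ℤ => e ((j + (1 - a) / 2) * z + (j + (1 - a) / 2 : ℂ) ^ 2 / 2 * τ)
          / (1 - e (z + (j + n + 1 / 2) * τ)))
        (1 / 2 * e ((n + a / 2 : ℂ) ^ 2 / 2 * τ)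
          * (-Complex.I * theta a 0 τ 0 * (theta a 0 τ z * theta 1 1 τ z / theta 0 1 τ z)
            + ∑ k ∈ Finset.range (2 * n + 1 + a),
                e (-(k - n - a / 2 : ℂ) ^ 2 / 2 * τ) * theta (1 - a) 0 τ z)) := by
  -- Translation by `τ/2` interchanges the characteristics `a` and `1 - a`. The common factor `κ` is
  -- divided out, and the factors `-i` cancel in the quotient.
  obtain ⟨hne, hsum⟩ := hasSum_integral_shift hτ ha n (z := z + 1 / 2 * τ) (fun j => by
    convert h j using 3
    ring)
  set κ := e (-(1 / 8 * τ) - 1 / 2 * z) with hκ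
  have hκ0 : κ ≠ 0 := e_ne_zero _
  have h0 : ∀ c, theta c 0 τ (z + 1 / 2 * τ) = κ * theta (c + 1) 0 τ z := fun c => by
    rw [theta_add_tau_half, hκ]
    simp
  have h1 : ∀ c, theta c 1 τ (z + 1 / 2 * τ) = κ * -Complex.I * theta (c + 1) 1 τ z := fun c => by
    rw [theta_add_tau_half, hκ, sub_eq_add_neg, e_add, e_neg, Int.cast_one, e_quarter, Complex.inv_I]
  have h11 : theta 1 1 τ (z + 1 / 2 * τ) = κ * -Complex.I * theta 0 1 τ z := by
    rw [h1, ← theta_add_two_left 0 1]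
    rfl
  have h01 : theta 0 1 τ (z + 1 / 2 * τ) = κ * -Complex.I * theta 1 1 τ z := by
    rw [h1]
    rfl
  have ha0 : theta a 0 τ (z + 1 / 2 * τ) = κ * theta (1 - a) 0 τ z := by
    rw [h0, ← theta_add_two_mul_left (1 - a) 0 τ z a]
    congr 2
    ring
  have ha1 : theta (1 - a) 0 τ (z + 1 / 2 * τ) = κ * theta a 0 τ z := by
    rw [h0, ← theta_add_two_mul_left a 0 τ z (1 - a)]
    congr 2
    ring
  have hne' : theta 0 1 τ z ≠ 0 := by
    rw [h11] at hne
    exact right_ne_zero_of_mul hne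
  refine ⟨hne', ?_⟩
  refine hasSum_of_eq_mul (c := κ⁻¹) hsum (fun j => ?_) ?_
  · rw [← mul_div_assoc, hκ, ← e_neg, ← e_add,
      show z + 1 / 2 * τ + (j + n) * τ = z + (j + n + 1 / 2) * τ by ring]
    refine congrArg (e · / _) ?_
    ring
  · simp only [h11, h01, ha0, ha1, ← Finset.sum_mul]
    have hI := Complex.I_ne_zero
    field_simp

end Formulas

lemma summable_and_two_mul_tsum {f g : ℤ → ℂ} {S c R : ℂ} (hf : HasSum f S)
    (hg : ∀ j, g j = c * f j) (hR : R = 2 * (c * S)) : Summable g ∧ 2 * ∑' j, g j = R := by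
  have h := hasSum_of_eq_mul hf hg rfl
  exact ⟨h.summable, by rw [h.tsum_eq, hR]⟩

lemma neg_one_zpow_eq_e (j : ℤ) : (-1 : ℂ) ^ j = e (j / 2) := by
  rw [← e_half, ← e_int_mul, mul_one_div]

lemma e_add_half (u : ℂ) : e (u + 1 / 2) = -e u := by
  rw [e_add, e_half, mul_neg_one]

end

end AppellSum

/-! ### The eight formulas. -/

open AppellSum in
theorem mainTheorem3 (n : ℕ) (τ z : ℂ) (hτ : 0 < τ.im) :
    ((∀ j : ℤ, 1 - e z * qpow τ ((j : ℂ) + n) ≠ 0) →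
      theta 1 1 τ z ≠ 0 ∧
      Summable (fun j : ℤ => (e ((j : ℂ) * z) * qpow τ ((j : ℂ) ^ 2 / 2)) / (1 - e z * qpow τ ((j : ℂ) + n))) ∧
      2 * ∑' j : ℤ, (e ((j : ℂ) * z) * qpow τ ((j : ℂ) ^ 2 / 2)) / (1 - e z * qpow τ ((j : ℂ) + n))
        = qpow τ ((n : ℂ) ^ 2 / 2) * (-Complex.I * theta 0 0 τ 0 * (theta 0 1 τ z * theta 1 0 τ z / theta 1 1 τ z)
            + ∑ k ∈ Finset.range (2 * n + 1),
              qpow τ (-((k : ℂ) - n) ^ 2 / 2) * theta 0 0 τ z)) ∧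
    ((∀ j : ℤ, 1 - e z * qpow τ ((j : ℂ) + n) ≠ 0) →
      theta 1 1 τ z ≠ 0 ∧
      Summable (fun j : ℤ => (e (((j : ℂ) - 1 / 2) * z) * qpow τ (((j : ℂ) - 1 / 2) ^ 2 / 2)) / (1 - e z * qpow τ ((j : ℂ) + n))) ∧
      2 * ∑' j : ℤ, (e (((j : ℂ) - 1 / 2) * z) * qpow τ (((j : ℂ) - 1 / 2) ^ 2 / 2)) / (1 - e z * qpow τ ((j : ℂ) + n))
        = qpow τ (((n : ℂ) + 1 / 2) ^ 2 / 2) * (-Complex.I * theta 1 0 τ 0 * (theta 0 1 τ z * theta 0 0 τ z / theta 1 1 τ z)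
            + ∑ k ∈ Finset.range (2 * n + 2),
              qpow τ (-((k : ℂ) - n - 1 / 2) ^ 2 / 2) * theta 1 0 τ z)) ∧
    ((∀ j : ℤ, 1 - e z * qpow τ ((j : ℂ) + n + 1 / 2) ≠ 0) →
      theta 0 1 τ z ≠ 0 ∧
      Summable (fun j : ℤ => (e ((j : ℂ) * z) * qpow τ ((j : ℂ) ^ 2 / 2)) / (1 - e z * qpow τ ((j : ℂ) + n + 1 / 2))) ∧
      2 * ∑' j : ℤ, (e ((j : ℂ) * z) * qpow τ ((j : ℂ) ^ 2 / 2)) / (1 - e z * qpow τ ((j : ℂ) + n + 1 / 2))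
        = qpow τ (((n : ℂ) + 1 / 2) ^ 2 / 2) * (-Complex.I * theta 1 0 τ 0 * (theta 1 0 τ z * theta 1 1 τ z / theta 0 1 τ z)
            + ∑ k ∈ Finset.range (2 * n + 2),
              qpow τ (-((k : ℂ) - n - 1 / 2) ^ 2 / 2) * theta 0 0 τ z)) ∧
    ((∀ j : ℤ, 1 - e z * qpow τ ((j : ℂ) + n + 1 / 2) ≠ 0) →
      theta 0 1 τ z ≠ 0 ∧
      Summable (fun j : ℤ => (e (((j : ℂ) + 1 / 2) * z) * qpow τ (((j : ℂ) + 1 / 2) ^ 2 / 2)) / (1 - e z * qpow τ ((j : ℂ) + n + 1 / 2))) ∧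
      2 * ∑' j : ℤ, (e (((j : ℂ) + 1 / 2) * z) * qpow τ (((j : ℂ) + 1 / 2) ^ 2 / 2)) / (1 - e z * qpow τ ((j : ℂ) + n + 1 / 2))
        = qpow τ ((n : ℂ) ^ 2 / 2) * (-Complex.I * theta 0 0 τ 0 * (theta 0 0 τ z * theta 1 1 τ z / theta 0 1 τ z)
            + ∑ k ∈ Finset.range (2 * n + 1),
              qpow τ (-((k : ℂ) - n) ^ 2 / 2) * theta 1 0 τ z)) ∧
    ((∀ j : ℤ, 1 + e z * qpow τ ((j : ℂ) + n) ≠ 0) →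
      theta 1 0 τ z ≠ 0 ∧
      Summable (fun j : ℤ => (-1 : ℂ) ^ j * (e ((j : ℂ) * z) * qpow τ ((j : ℂ) ^ 2 / 2)) / (1 + e z * qpow τ ((j : ℂ) + n))) ∧
      2 * ∑' j : ℤ, (-1 : ℂ) ^ j * (e ((j : ℂ) * z) * qpow τ ((j : ℂ) ^ 2 / 2)) / (1 + e z * qpow τ ((j : ℂ) + n))
        = qpow τ ((n : ℂ) ^ 2 / 2) * (Complex.I * theta 0 0 τ 0 * (theta 0 0 τ z * theta 1 1 τ z / theta 1 0 τ z)
            + ∑ k ∈ Finset.range (2 * n + 1),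
              qpow τ (-((k : ℂ) - n) ^ 2 / 2) * theta 0 1 τ z)) ∧
    ((∀ j : ℤ, 1 + e z * qpow τ ((j : ℂ) + n) ≠ 0) →
      theta 1 0 τ z ≠ 0 ∧
      Summable (fun j : ℤ => (-1 : ℂ) ^ j * (e (((j : ℂ) - 1 / 2) * z) * qpow τ (((j : ℂ) - 1 / 2) ^ 2 / 2)) / (1 + e z * qpow τ ((j : ℂ) + n))) ∧
      2 * ∑' j : ℤ, (-1 : ℂ) ^ j * (e (((j : ℂ) - 1 / 2) * z) * qpow τ (((j : ℂ) - 1 / 2) ^ 2 / 2)) / (1 + e z * qpow τ ((j : ℂ) + n))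
        = qpow τ (((n : ℂ) + 1 / 2) ^ 2 / 2) * (-theta 1 0 τ 0 * (theta 0 1 τ z * theta 0 0 τ z / theta 1 0 τ z)
            + Complex.I * ∑ k ∈ Finset.range (2 * n + 2),
              qpow τ (-((k : ℂ) - n - 1 / 2) ^ 2 / 2) * theta 1 1 τ z)) ∧
    ((∀ j : ℤ, 1 + e z * qpow τ ((j : ℂ) + n + 1 / 2) ≠ 0) →
      theta 0 0 τ z ≠ 0 ∧
      Summable (fun j : ℤ => (-1 : ℂ) ^ j * (e ((j : ℂ) * z) * qpow τ ((j : ℂ) ^ 2 / 2)) / (1 + e z * qpow τ ((j : ℂ) + n + 1 / 2))) ∧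
      2 * ∑' j : ℤ, (-1 : ℂ) ^ j * (e ((j : ℂ) * z) * qpow τ ((j : ℂ) ^ 2 / 2)) / (1 + e z * qpow τ ((j : ℂ) + n + 1 / 2))
        = qpow τ (((n : ℂ) + 1 / 2) ^ 2 / 2) * (Complex.I * theta 1 0 τ 0 * (theta 1 1 τ z * theta 1 0 τ z / theta 0 0 τ z)
            + ∑ k ∈ Finset.range (2 * n + 2),
              qpow τ (-((k : ℂ) - n - 1 / 2) ^ 2 / 2) * theta 0 1 τ z)) ∧
    ((∀ j : ℤ, 1 + e z * qpow τ ((j : ℂ) + n + 1 / 2) ≠ 0) →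
      theta 0 0 τ z ≠ 0 ∧
      Summable (fun j : ℤ => (-1 : ℂ) ^ j * (e (((j : ℂ) + 1 / 2) * z) * qpow τ (((j : ℂ) + 1 / 2) ^ 2 / 2)) / (1 + e z * qpow τ ((j : ℂ) + n + 1 / 2))) ∧
      2 * ∑' j : ℤ, (-1 : ℂ) ^ j * (e (((j : ℂ) + 1 / 2) * z) * qpow τ (((j : ℂ) + 1 / 2) ^ 2 / 2)) / (1 + e z * qpow τ ((j : ℂ) + n + 1 / 2))
        = qpow τ ((n : ℂ) ^ 2 / 2) * (theta 0 0 τ 0 * (theta 0 1 τ z * theta 1 0 τ z / theta 0 0 τ z)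
            - Complex.I * ∑ k ∈ Finset.range (2 * n + 1),
              qpow τ (-((k : ℂ) - n) ^ 2 / 2) * theta 1 1 τ z)) := by
  have hq := qpow_eq_e τ
  have hz : ∀ (c : ℂ), e (z + 1 / 2 + c) = -e (z + c) := fun c => by
    rw [add_right_comm, e_add_half]
  have p0 := theta_add_half (τ := τ) (z := z)
  have h00 : theta 0 1 τ (z + 1 / 2) = theta 0 0 τ z := by
    rw [p0]; simpa [e_zero] using theta_add_two_right 0 0 τ z
  have h10 : theta 1 1 τ (z + 1 / 2) = -theta 1 0 τ z := by
    rw [p0]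
    have := theta_add_two_right 1 0 τ z
    rw [Int.cast_one, e_half, neg_one_mul] at this
    exact this
  have h01 : theta 0 0 τ (z + 1 / 2) = theta 0 1 τ z := p0 0 0
  have h11 : theta 1 0 τ (z + 1 / 2) = theta 1 1 τ z := p0 1 0
  simp only [hq, neg_one_zpow_eq_e, ← e_add]
  refine ⟨fun h => ?_, fun h => ?_, fun h => ?_, fun h => ?_, fun h => ?_, fun h => ?_, fun h => ?_,
    fun h => ?_⟩
  · obtain ⟨h1, h2⟩ := hasSum_integral_shift hτ (Or.inl rfl) n h
    refine ⟨h1, summable_and_two_mul_tsum (c := 1) h2 (fun j => ?_) ?_⟩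
    · simp
    · simp
      ring
  · obtain ⟨h1, h2⟩ := hasSum_integral_shift hτ (Or.inr rfl) n h
    refine ⟨h1, summable_and_two_mul_tsum (c := 1) h2 (fun j => ?_) ?_⟩
    · simp
    · simp
      ring
  -- The numerator offset is now `(1 - a)/2`, so the integral exponents correspond to `a = 1`.
  · obtain ⟨h1, h2⟩ := hasSum_half_integral_shift hτ (Or.inr rfl) n h
    refine ⟨h1, summable_and_two_mul_tsum (c := 1) h2 (fun j => ?_) ?_⟩
    · simp
    · simp
      ring
  · obtain ⟨h1, h2⟩ := hasSum_half_integral_shift hτ (Or.inl rfl) n h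
    refine ⟨h1, summable_and_two_mul_tsum (c := 1) h2 (fun j => ?_) ?_⟩
    · simp
    · simp
      ring
  -- Translation by `1/2` flips the sign of `e(z)` and creates `(-1)^j = e(j/2)`.
  · obtain ⟨h1, h2⟩ := hasSum_integral_shift hτ (Or.inl rfl) n (z := z + 1 / 2)
      (fun j => by rw [hz, sub_neg_eq_add]; exact h j)
    simp only [Nat.cast_zero, zero_div, add_zero, sub_zero, h00, h01, h10, h11] at h1 h2
    refine ⟨neg_ne_zero.1 h1, summable_and_two_mul_tsum (c := 1) h2 (fun j => ?_) ?_⟩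
    · rw [hz, sub_neg_eq_add, one_mul]
      refine congrArg (e · / _) ?_
      ring
    · simp only [← Finset.sum_mul, div_neg]
      ring
  · obtain ⟨h1, h2⟩ := hasSum_integral_shift hτ (Or.inr rfl) n (z := z + 1 / 2)
      (fun j => by rw [hz, sub_neg_eq_add]; exact h j)
    simp only [Nat.cast_one, sub_self, h00, h01, h10, h11] at h1 h2
    -- The offset `-1/2` contributes the extra phase `e(-1/4) = -i`, which the factor `i` undoes; in
    -- the last formula the roles of `i` and `-i` are reversed.
    refine ⟨neg_ne_zero.1 h1, summable_and_two_mul_tsum (c := Complex.I) h2 (fun j => ?_) ?_⟩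
    · rw [hz, sub_neg_eq_add, ← e_quarter, ← mul_div_assoc, ← e_add]
      refine congrArg (e · / _) ?_
      ring
    · simp only [← Finset.sum_mul, div_neg]
      linear_combination (-(e (((n : ℂ) + 1 / 2) ^ 2 / 2 * τ) * theta 1 0 τ 0
        * (theta 0 0 τ z * theta 0 1 τ z / theta 1 0 τ z))) * Complex.I_sq
  · obtain ⟨h1, h2⟩ := hasSum_half_integral_shift hτ (Or.inr rfl) n (z := z + 1 / 2)
      (fun j => by rw [hz, sub_neg_eq_add]; exact h j)
    simp only [Nat.cast_one, sub_self, h00, h01, h10, h11] at h1 h2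
    refine ⟨h1, summable_and_two_mul_tsum (c := 1) h2 (fun j => ?_) ?_⟩
    · rw [hz, sub_neg_eq_add, one_mul]
      refine congrArg (e · / _) ?_
      ring
    · simp only [← Finset.sum_mul, mul_neg, neg_div]
      ring
  · obtain ⟨h1, h2⟩ := hasSum_half_integral_shift hτ (Or.inl rfl) n (z := z + 1 / 2)
      (fun j => by rw [hz, sub_neg_eq_add]; exact h j)
    simp only [Nat.cast_zero, zero_div, add_zero, sub_zero, h00, h01, h10, h11] at h1 h2
    refine ⟨h1, summable_and_two_mul_tsum (c := -Complex.I) h2 (fun j => ?_) ?_⟩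
    · rw [hz, sub_neg_eq_add, ← Complex.inv_I, ← e_quarter, ← e_neg, ← mul_div_assoc, ← e_add]
      refine congrArg (e · / _) ?_
      ring
    · simp only [← Finset.sum_mul, mul_neg, neg_div]
      linear_combination (e ((n : ℂ) ^ 2 / 2 * τ) * theta 0 0 τ 0
        * (theta 0 1 τ z * theta 1 0 τ z / theta 0 0 τ z)) * Complex.I_sq
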